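/- \textbf{Theorem.} Let $\delta_-,\delta_+\in[0,1/2)$ and $\mu\ge 1$. There is a constant $C$, depending only on $\delta_-,\delta_+,\mu$, such that the following holds for all $\nu\in(0,1]$, all $d\in[-\delta_-,\delta_+]$ and all $f_\star:[-\pi,\pi]\to[0,\infty)$. Assume that $f_\star$ is integrable, continuous at $0$ with $0<f_\star(0)<\infty$, that $f_\star\in\mathcal L(\mu,\nu)$, i.e. $f_\star(\omega)\le\mu f_\star(0)$ for $\omega\in[-\pi,\pi]$ and, for all $\omega,\omega'\in[-\pi,\pi]\setminus\{0\}$, $$|f_\star(\omega)-f_\star(\omega')|\le\mu f_\star(0)\frac{|\omega-\omega'|}{|\omega|\wedge|\omega'|},\qquad |f_\star(\omega)-f_\star(\omega')|\le\mu f_\star(0)\big||\omega|-|\omega'|\big|^{\nu},$$ and that $f_\star(\omega)\ge\mu^{-1}f_\star(0)$ for $|\omega|\le\pi/2$. Let $(X_t)_{t\in\mathbb Z}$ be a real covariance stationary process with spectral density $f(\omega)=|\omega|^{-2d}f_\star(\omega)$, $\omega\in[-\pi,\pi]$, i.e. $\mathrm{Cov}(X_s,X_t)=\int_{-\pi}^{\pi}e^{i(t-s)\omega}f(\omega)\,d\omega$.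 Put $\omega_k=2\pi k/n$, $d_{\ell,n}(\omega)=(2\pi n)^{-1/2}\sum_{t=1}^{n}X_{t+\ell n}e^{it\omega}$ and $I_{\ell,n}(\omega)=|d_{\ell,n}(\omega)|^2$. Then: (i) for all integers $n$ and $1\le k\le n/4$, $$\left|\mathbb E\big[f^{-1}(\omega_k)I_{0,n}(\omega_k)\big]-1\right|\le C\,\frac{\log(1+k)}{k};$$ (ii) for all integers $n$, $1\le j<k\le n/4$ and $\ell\ge1$, $$f^{-1/2}(\omega_j)f^{-1/2}(\omega_k)\Big(\big|\mathbb E[d_{0,n}(\omega_j)\overline{d_{\ell,n}(\omega_k)}]\big|+\big|\mathbb E[d_{0,n}(\omega_j)d_{\ell,n}(\omega_k)]\big|\Big)\le C\log(k)\,j^{-|d|}k^{|d|-1}\Big(\ell^{-\{(1-2d)\wedge1\}}+(\ell n)^{-\nu}\Big);$$ (iii) for $\ell=0$ and all integers $n$, $1\le j<k\le n/4$, the left-hand side of (ii) is at most $C\log(k)\,j^{-|d|}k^{|d|-1}$. -/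

import Mathlib

open MeasureTheory

noncomputable section

namespace LongMemory

/-- The class of functions `φ : [-π, π] → [0, ∞)` (values outside `[-π, π]` are irrelevant) with
`φ ≤ μ φ(0)` and with the two local Lipschitz / Hölder conditions away from the origin. -/
structure LocalLipschitz (μ ν : ℝ) (φ : ℝ → ℝ) : Prop where
  nonneg : ∀ ω ∈ Set.Icc (-Real.pi) Real.pi, 0 ≤ φ ω
  le_mul : ∀ ω ∈ Set.Icc (-Real.pi) Real.pi, φ ω ≤ μ * φ 0
  lipschitz : ∀ ω ∈ Set.Icc (-Real.pi) Real.pi, ∀ ω' ∈ Set.Icc (-Real.pi) Real.pi,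
    ω ≠ 0 → ω' ≠ 0 → |φ ω - φ ω'| ≤ μ * φ 0 * (|ω - ω'| / min |ω| |ω'|)
  holder : ∀ ω ∈ Set.Icc (-Real.pi) Real.pi, ∀ ω' ∈ Set.Icc (-Real.pi) Real.pi,
    ω ≠ 0 → ω' ≠ 0 → |φ ω - φ ω'| ≤ μ * φ 0 * |(|ω| - |ω'|)| ^ ν

/-- Conditions on the short-memory factor `fstar` of a spectral density. -/
structure IsShortMemoryFactor (fstar : ℝ → ℝ) : Prop where
  continuousAt_zero : ContinuousAt fstar 0
  pos_zero : 0 < fstar 0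
  integrableOn : IntegrableOn fstar (Set.Icc (-Real.pi) Real.pi)

/-- `f(ω) = |ω|^(-2d) fstar(ω)`. -/
def memoryDensity (d : ℝ) (fstar : ℝ → ℝ) (ω : ℝ) : ℝ := |ω| ^ (-2 * d) * fstar ω

/-- The real process `(X_t)_{t ∈ ℤ}` is covariance stationary with spectral density `f` on
`[-π, π]`: it is square integrable, has constant mean, and
`Cov(X_s, X_t) = ∫_{-π}^{π} e^{i (t - s) ω} f(ω) dω`, with `f` nonnegative and integrable. -/
structure HasSpectralDensity {Ω : Type*} [MeasurableSpace Ω] (P : Measure Ω)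
    (X : ℤ → Ω → ℝ) (f : ℝ → ℝ) : Prop where
  memLp : ∀ t, MemLp (X t) 2 P
  mean_eq : ∀ s t, ∫ x, X s x ∂P = ∫ x, X t x ∂P
  density_nonneg : ∀ ω ∈ Set.Icc (-Real.pi) Real.pi, 0 ≤ f ω
  density_integrable : IntegrableOn f (Set.Icc (-Real.pi) Real.pi)
  covariance_eq : ∀ s t : ℤ, ((ProbabilityTheory.covariance (X s) (X t) P : ℝ) : ℂ) =
    ∫ ω in (-Real.pi)..Real.pi,
      Complex.exp (Complex.I * ((((t - s : ℤ) : ℝ) * ω : ℝ) : ℂ)) * ((f ω : ℝ) : ℂ)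

/-- The Fourier frequency `ω_k = 2πk/n`. -/
def fourierFreq (n k : ℕ) : ℝ := 2 * Real.pi * (k : ℝ) / (n : ℝ)

/-- The discrete Fourier transform of epoch `ℓ`,
`(2πn)^(-1/2) ∑_{t=1}^{n} X_{t+ℓn} e^{i t ω}`. -/
def dft {Ω : Type*} (X : ℤ → Ω → ℝ) (ℓ n : ℕ) (ω : ℝ) (x : Ω) : ℂ :=
  (((Real.sqrt (2 * Real.pi * (n : ℝ)))⁻¹ : ℝ) : ℂ) *
    ∑ t ∈ Finset.Icc 1 n,
      ((X ((t + ℓ * n : ℕ) : ℤ) x : ℝ) : ℂ) * Complex.exp (Complex.I * (((t : ℝ) * ω : ℝ) : ℂ))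

/-- The periodogram of epoch `ℓ`. -/
def periodogram {Ω : Type*} (X : ℤ → Ω → ℝ) (ℓ n : ℕ) (ω : ℝ) (x : Ω) : ℝ :=
  ‖dft X ℓ n ω x‖ ^ 2

/-- `f(ω_j)^(-1/2) f(ω_k)^(-1/2) (|E[d_{0,n}(ω_j) conj d_{ℓ,n}(ω_k)]| + |E[d_{0,n}(ω_j) d_{ℓ,n}(ω_k)]|)`. -/
def normalizedCrossMoment {Ω : Type*} [MeasurableSpace Ω] (P : Measure Ω)
    (X : ℤ → Ω → ℝ) (f : ℝ → ℝ) (n j k ℓ : ℕ) : ℝ :=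
  (f (fourierFreq n j)) ^ (-(1 / 2) : ℝ) * (f (fourierFreq n k)) ^ (-(1 / 2) : ℝ) *
    (‖∫ x, dft X 0 n (fourierFreq n j) x *
          (starRingEnd ℂ) (dft X ℓ n (fourierFreq n k) x) ∂P‖ +
      ‖∫ x, dft X 0 n (fourierFreq n j) x * dft X ℓ n (fourierFreq n k) x ∂P‖)

end LongMemory

end

open LongMemory

open MeasureTheory

noncomputable section

namespace LongMemory

/-! For Fourier frequencies a = ω_j and b = ±ω_k, the moment E[d_0(a) d_ℓ(-b)] equals (2πn)⁻¹ ∫ f(ω)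
e^{iℓnω} D(a-ω) D(ω-b) dω, with D the Dirichlet kernel (`HasSpectralDensity.integral_dft_mul_dft`);
the mean of the process drops out because D(ω_j) = 0. The two signs of b give the two moments in
(ii), since conjugation turns d(ω) into d(-ω).

Size. Each factor D is dominated by a regularised 1/|ω - centre|, but the product of two nearby
kernels is too large to integrate directly. A constant c is therefore subtracted from f. When j ≠ k
this is free, because c ∫ e^{iℓnω} D D = 0 for the c that is chosen; when j = k and ℓ = 0 it
produces the main term f(ω_k). If the centres are separated, c = 0 and partial fractions leave one
kernel; if they are comparable, c = f(ω_k) and the regularity of f cancels one kernel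
(`abs_sub_mul_kern_le`). A single kernel integrates to a logarithm (`integral_majorant_le`). This
settles (i), (iii) and ℓ = 1.

Decay in ℓ. For ℓ ≥ 2, a shift by the half period h = π/(ℓn) of e^{iℓnω} bounds the integral by the
L¹ norm of the increments of (f-c) D D (`norm_integral_char_mul_le`). Increments of D D, and those
of f where |ω| ≥ ω_j/2, gain a factor 1/ℓ. Where |ω| ≤ ω_j/2, the L¹ increment of |ω|^{-2d} gains
ℓ^{-min(1-2d,1)} and the Hölder bound on the short-memory factor gains (ℓn)^{-ν}
(`norm_integral_oscillating_le`).

Finally, the normalisation turns ω_j^{-2d} + ω_k^{-2d} into a multiple of (k/j)^{|d|}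
(`normalizedCrossMoment_le`). -/

/-! ### Elementary inequalities for real powers. -/

/-- By symmetry and homogeneity x = t y with t ≥ 1, and then t^p lies between t⁻¹ and t. The bound
has the shape of the Lipschitz condition on the short-memory factor, so the two combine in a product
rule. -/
theorem abs_rpow_sub_rpow_le {p x y : ℝ} (hp : |p| ≤ 1) (hx : 0 < x) (hy : 0 < y) :
    |x ^ p - y ^ p| ≤ (x ^ p + y ^ p) * (|x - y| / min x y) := by
  wlog h : y ≤ x generalizing x y
  · have := this hy hx (le_of_not_ge h)
    rwa [abs_sub_comm, add_comm, abs_sub_comm x y, min_comm]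
  obtain ⟨t, ht, rfl⟩ : ∃ t : ℝ, 1 ≤ t ∧ x = t * y :=
    ⟨x / y, (one_le_div hy).2 h, by field_simp⟩
  have ht0 : 0 < t := by linarith
  have hyp := Real.rpow_pos_of_pos hy p
  have htp := Real.rpow_pos_of_pos ht0 p
  rw [min_eq_right h, Real.mul_rpow ht0.le hy.le]
  have e1 : |t * y - y| / y = t - 1 := by
    rw [abs_of_nonneg (by linarith)]; field_simp
  rw [e1]
  have e2 : t ^ p * y ^ p - y ^ p = (t ^ p - 1) * y ^ p := by ring
  rw [e2, abs_mul, abs_of_pos hyp]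
  have hp' := abs_le.1 hp
  have key : |t ^ p - 1| ≤ (t ^ p + 1) * (t - 1) := by
    rcases le_total 0 p with h0 | h0
    · have h1 : t ^ p ≤ t := by
        simpa using Real.rpow_le_rpow_of_exponent_le ht hp'.2
      have h2 : 1 ≤ t ^ p := Real.one_le_rpow ht h0
      rw [abs_of_nonneg (by linarith)]
      nlinarith
    · have h1 : t⁻¹ ≤ t ^ p := by
        simpa [Real.rpow_neg_one] using Real.rpow_le_rpow_of_exponent_le ht hp'.1
      have h2 : t ^ p ≤ 1 := Real.rpow_le_one_of_one_le_of_nonpos ht h0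
      have h3 : t * t⁻¹ = 1 := by field_simp
      have h4 : 0 < t⁻¹ := by positivity
      rw [abs_of_nonpos (by linarith)]
      nlinarith
  calc |t ^ p - 1| * y ^ p ≤ (t ^ p + 1) * (t - 1) * y ^ p := by gcongr
    _ = _ := by ring

/-- The sum on the right covers both signs of p: the upper endpoint serves p ≥ 0, the lower one p ≤
0. -/
theorem rpow_le_two_mul_add {p a b x : ℝ} (hp : |p| ≤ 1) (ha : 0 < a) (hb : 0 < b)
    (h1 : a / 2 ≤ x) (h2 : x ≤ 2 * b) : x ^ p ≤ 2 * (a ^ p + b ^ p) := by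
  have hp' := abs_le.1 hp
  have hap := Real.rpow_pos_of_pos ha p
  have hbp := Real.rpow_pos_of_pos hb p
  rcases le_total 0 p with h0 | h0
  · have h3 : x ^ p ≤ (2 * b) ^ p := Real.rpow_le_rpow (by linarith) h2 h0
    rw [Real.mul_rpow (by norm_num) hb.le] at h3
    have h4 : (2 : ℝ) ^ p ≤ 2 := by
      simpa using Real.rpow_le_rpow_of_exponent_le (x := 2) (by norm_num) hp'.2
    nlinarith
  · have h3 : x ^ p ≤ (a / 2) ^ p := Real.rpow_le_rpow_of_nonpos (by linarith) h1 h0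
    rw [div_eq_mul_inv, Real.mul_rpow ha.le (by norm_num), Real.inv_rpow (by norm_num),
      ← Real.rpow_neg (by norm_num)] at h3
    have h4 : (2 : ℝ) ^ (-p) ≤ 2 := by
      simpa using Real.rpow_le_rpow_of_exponent_le (x := 2) (by norm_num) (by linarith : -p ≤ 1)
    nlinarith

theorem integral_symm_eq {φ : ℝ → ℝ} {r : ℝ} (hr : 0 ≤ r)
    (hφ : IntervalIntegrable φ volume (-r) r) :
    ∫ x in (-r)..r, φ x = ∫ x in (0 : ℝ)..r, (φ x + φ (-x)) := by
  have h0 : (0 : ℝ) ∈ Set.uIcc (-r) r := by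
    rw [Set.mem_uIcc]; left; constructor <;> linarith
  have i1 : IntervalIntegrable φ volume (-r) 0 :=
    hφ.mono_set (Set.uIcc_subset_uIcc_left h0)
  have i2 : IntervalIntegrable φ volume 0 r :=
    hφ.mono_set (Set.uIcc_subset_uIcc_right h0)
  have i3 : IntervalIntegrable (fun x => φ (-x)) volume 0 r := by
    have := i1.symm.comp_sub_left 0
    simpa using this
  rw [intervalIntegral.integral_add i2 i3, intervalIntegral.integral_comp_neg,
    ← intervalIntegral.integral_add_adjacent_intervals i1 i2]
  simp [add_comm]

/-! ### Integrals of powers against one kernel. -/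

/-- The kernel dominating a Dirichlet kernel centred at `a`. -/
def kern (ε a x : ℝ) : ℝ := 1 / (ε + |x - a|)

theorem kern_pos {ε : ℝ} (hε : 0 < ε) (a x : ℝ) : 0 < kern ε a x := by
  unfold kern; positivity

theorem continuous_kern {ε : ℝ} (hε : 0 < ε) (a : ℝ) : Continuous (kern ε a) := by
  unfold kern
  refine continuous_const.div (by fun_prop) fun x => ?_
  positivity

/-- Enlarging the interval to one symmetric about a gives an explicit primitive. This is the source
of the logarithm in the theorem. -/
theorem integral_kern_le {ε a c d r : ℝ} (hε : 0 < ε) (hcd : c ≤ d) (hc : a - r ≤ c)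
    (hd : d ≤ a + r) : ∫ x in c..d, kern ε a x ≤ 2 * Real.log (1 + r / ε) := by
  have hr : 0 ≤ r := by linarith
  calc ∫ x in c..d, kern ε a x ≤ ∫ x in (a - r)..(a + r), kern ε a x := by
        refine intervalIntegral.integral_mono_interval hc hcd hd
          (Filter.Eventually.of_forall fun x => (kern_pos hε a x).le)
          ((continuous_kern hε a).intervalIntegrable _ _)
    _ = ∫ x in (-r)..r, kern ε a (x + a) := by
        rw [intervalIntegral.integral_comp_add_right]; congr 1 <;> ring
    _ = ∫ x in (0 : ℝ)..r, (kern ε a (x + a) + kern ε a (-x + a)) :=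
        integral_symm_eq hr (((continuous_kern hε a).comp
          (continuous_id.add continuous_const)).intervalIntegrable _ _)
    _ = ∫ x in (0 : ℝ)..r, 2 * (1 / (ε + x)) := by
        refine intervalIntegral.integral_congr fun x hx => ?_
        rw [Set.uIcc_of_le hr] at hx
        simp only [kern, add_sub_cancel_right, abs_neg, abs_of_nonneg hx.1]
        ring
    _ = 2 * Real.log ((ε + r) / ε) := by
        rw [intervalIntegral.integral_const_mul,
          intervalIntegral.integral_comp_add_left (fun x => 1 / x),
          integral_one_div_of_pos (by linarith) (by linarith), add_zero]
    _ = 2 * Real.log (1 + r / ε) := by congr 2; field_simp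

/-- κ measures how far p stays from ±1; through it the constants become uniform in d. -/
theorem integral_rpow_zero_le {p κ A : ℝ} (hκ : 0 < κ) (hp : |p| ≤ 1 - κ) (hA : 0 ≤ A) :
    ∫ x in (0 : ℝ)..A, x ^ p ≤ A ^ (p + 1) / κ := by
  have hp' := abs_le.1 hp
  rw [integral_rpow (Or.inl (by linarith)), Real.zero_rpow (by linarith), sub_zero]
  exact div_le_div_of_nonneg_left (Real.rpow_nonneg hA _) hκ (by linarith)

theorem intervalIntegrable_abs_rpow {p : ℝ} (hp : -1 < p) (a b : ℝ) :
    IntervalIntegrable (fun x : ℝ => |x| ^ p) volume a b := by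
  have h : ∀ r : ℝ, 0 ≤ r → IntervalIntegrable (fun x : ℝ => |x| ^ p) volume 0 r := by
    intro r hr
    refine (intervalIntegral.intervalIntegrable_rpow' (a := 0) (b := r) hp).congr ?_
    intro x hx
    rw [Set.uIoc_of_le hr] at hx
    simp only [abs_of_pos hx.1]
  have h' : ∀ r : ℝ, IntervalIntegrable (fun x : ℝ => |x| ^ p) volume 0 r := by
    intro r
    rcases le_total 0 r with hr | hr
    · exact h r hr
    · have := (h (-r) (by linarith)).comp_sub_left 0
      simpa using this
  exact (h' a).symm.trans (h' b)

/-- Split at a/2 and 2β. Below a/2 the kernel is at most 2/a and x^p is integrable at 0; in the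
middle x^p is bounded by its size at a and β, and the kernel gives the logarithm; beyond 2β the
integrand is O(x^{p-2}). -/
theorem integral_rpow_mul_kern_le {p κ ε a β : ℝ} (hκ : 0 < κ) (hp : |p| ≤ 1 - κ) (hε : 0 < ε)
    (ha : 0 < a) (haβ : a ≤ β) (hβ : 2 * β ≤ Real.pi) :
    ∫ x in (0 : ℝ)..Real.pi, x ^ p / (β + x) * kern ε a x ≤
      8 / κ * ((a ^ p + β ^ p) * (1 + Real.log (1 + β / ε)) / β) := by
  have hp' := abs_le.1 hp
  have hp1 : |p| ≤ 1 := by linarith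
  have hκ1 : κ ≤ 1 := by linarith [abs_nonneg p]
  have hβ0 : 0 < β := by linarith
  have hM : 0 < a ^ p + β ^ p := by
    have := Real.rpow_pos_of_pos ha p
    have := Real.rpow_pos_of_pos hβ0 p
    linarith
  set M := a ^ p + β ^ p
  have hΛ : 0 ≤ Real.log (1 + β / ε) := Real.log_nonneg (by
    have : 0 < β / ε := by positivity
    linarith)
  set Λ := Real.log (1 + β / ε)
  have hint : ∀ c d : ℝ, 0 ≤ c → c ≤ d →
      IntervalIntegrable (fun x : ℝ => x ^ p / (β + x) * kern ε a x) volume c d := by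
    intro c d hc hcd
    have : (fun x : ℝ => x ^ p / (β + x) * kern ε a x) =
        fun x => x ^ p * (1 / (β + x) * kern ε a x) := by
      funext x; ring
    rw [this]
    refine (intervalIntegral.intervalIntegrable_rpow' (by linarith)).mul_continuousOn ?_
    refine ContinuousOn.mul (continuousOn_const.div (by fun_prop) ?_)
      (continuous_kern hε a).continuousOn
    intro x hx
    rw [Set.uIcc_of_le hcd] at hx
    have : 0 ≤ x := hc.trans hx.1
    positivity
  rw [← intervalIntegral.integral_add_adjacent_intervals
    (hint 0 (a / 2) le_rfl (by linarith)) (hint (a / 2) Real.pi (by linarith) (by linarith)),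
    ← intervalIntegral.integral_add_adjacent_intervals
    (hint (a / 2) (2 * β) (by linarith) (by linarith)) (hint (2 * β) Real.pi (by linarith) hβ)]
  have b1 : ∫ x in (0 : ℝ)..(a / 2), x ^ p / (β + x) * kern ε a x ≤ 2 * M / (κ * β) := by
    calc _ ≤ ∫ x in (0 : ℝ)..(a / 2), (2 / (β * a)) * x ^ p := by
          refine intervalIntegral.integral_mono_on (by linarith) (hint _ _ le_rfl (by linarith))
            ((intervalIntegral.intervalIntegrable_rpow' (by linarith)).const_mul _) ?_
          intro x hx
          have hxp := Real.rpow_nonneg hx.1 p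
          have h1 : kern ε a x ≤ 2 / a := by
            unfold kern
            rw [div_le_div_iff₀ (by positivity) ha, abs_sub_comm]
            have := le_abs_self (a - x)
            have := hx.2
            nlinarith
          have h2 : x ^ p / (β + x) ≤ x ^ p / β :=
            div_le_div_of_nonneg_left hxp hβ0 (by linarith [hx.1])
          calc _ ≤ x ^ p / β * (2 / a) :=
                mul_le_mul h2 h1 (kern_pos hε a x).le (by positivity)
            _ = _ := by field_simp
      _ ≤ (2 / (β * a)) * ((a / 2) ^ (p + 1) / κ) := by
          rw [intervalIntegral.integral_const_mul]
          have := integral_rpow_zero_le hκ hp (by linarith : (0 : ℝ) ≤ a / 2)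
          gcongr
      _ ≤ (2 / (β * a)) * (a ^ (p + 1) / κ) := by
          have : (a / 2) ^ (p + 1) ≤ a ^ (p + 1) :=
            Real.rpow_le_rpow (by linarith) (by linarith) (by linarith)
          gcongr
      _ = 2 * a ^ p / (κ * β) := by
          rw [Real.rpow_add ha, Real.rpow_one]; field_simp
      _ ≤ _ := by
          have := Real.rpow_pos_of_pos hβ0 p
          gcongr
          simp only [M]; linarith
  have b2 : ∫ x in (a / 2)..(2 * β), x ^ p / (β + x) * kern ε a x ≤
      4 * M * (1 + Λ) / (κ * β) * 1 := by
    calc _ ≤ ∫ x in (a / 2)..(2 * β), (2 * M / β) * kern ε a x := by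
          refine intervalIntegral.integral_mono_on (by linarith)
            (hint _ _ (by linarith) (by linarith))
            (((continuous_kern hε a).intervalIntegrable _ _).const_mul _) ?_
          intro x hx
          have hx0 : 0 < x := by linarith [hx.1]
          have h3 := rpow_le_two_mul_add hp1 ha hβ0 hx.1 hx.2
          have h4 : x ^ p / (β + x) ≤ 2 * M / β :=
            div_le_div₀ (by positivity) h3 hβ0 (by linarith)
          exact mul_le_mul_of_nonneg_right h4 (kern_pos hε a x).le
      _ ≤ (2 * M / β) * (2 * Real.log (1 + (2 * β) / ε)) := by
          rw [intervalIntegral.integral_const_mul]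
          have := integral_kern_le (ε := ε) (a := a) (r := 2 * β) (c := a / 2) (d := 2 * β) hε
            (by linarith) (by linarith) (by linarith)
          gcongr
      _ ≤ (2 * M / β) * (2 * (1 + Λ)) := by
          have : Real.log (1 + 2 * β / ε) ≤ 1 + Λ := by
            have h5 : Real.log (1 + 2 * β / ε) ≤ Real.log (2 * (1 + β / ε)) := by
              refine Real.log_le_log (by positivity) ?_
              have : 2 * β / ε = 2 * (β / ε) := by ring
              linarith
            rw [Real.log_mul (by norm_num) (by positivity)] at h5
            have := Real.log_two_lt_d9
            simp only [Λ]
            linarith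
          gcongr
      _ = 4 * M * (1 + Λ) / β := by ring
      _ ≤ _ := by
          rw [mul_one]
          refine div_le_div_of_nonneg_left (by positivity) (by positivity) ?_
          nlinarith
  have b3 : ∫ x in (2 * β)..Real.pi, x ^ p / (β + x) * kern ε a x ≤ 2 * M / (κ * β) := by
    have hnot : (0 : ℝ) ∉ Set.uIcc (2 * β) Real.pi := by
      rw [Set.uIcc_of_le hβ]; intro h; linarith [h.1]
    calc _ ≤ ∫ x in (2 * β)..Real.pi, 2 * x ^ (p - 2) := by
          refine intervalIntegral.integral_mono_on hβ
            (hint _ _ (by linarith) hβ)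
            ((intervalIntegral.intervalIntegrable_rpow (Or.inr hnot)).const_mul _) ?_
          intro x hx
          have hx0 : 0 < x := by linarith [hx.1]
          have hxp := Real.rpow_pos_of_pos hx0 p
          have h1 : kern ε a x ≤ 2 / x := by
            unfold kern
            rw [div_le_div_iff₀ (by positivity) hx0]
            have := le_abs_self (x - a)
            have := hx.1
            nlinarith
          have h2 : x ^ p / (β + x) ≤ x ^ p / x :=
            div_le_div_of_nonneg_left hxp.le hx0 (by linarith)
          calc _ ≤ x ^ p / x * (2 / x) :=
                mul_le_mul h2 h1 (kern_pos hε a x).le (by positivity)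
            _ = _ := by
                rw [Real.rpow_sub hx0, Real.rpow_two]; field_simp
      _ = 2 * (((2 * β) ^ (p - 1) - Real.pi ^ (p - 1)) / (1 - p)) := by
          rw [intervalIntegral.integral_const_mul,
            integral_rpow (Or.inr ⟨by intro h; linarith, hnot⟩)]
          have : p - 2 + 1 = p - 1 := by ring
          rw [this]
          have h1 : p - 1 ≠ 0 := by intro h; linarith
          have h2 : 1 - p ≠ 0 := by intro h; linarith
          field_simp
          ring
      _ ≤ 2 * (β ^ (p - 1) / κ) := by
          have h1 : (2 * β) ^ (p - 1) ≤ β ^ (p - 1) :=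
            Real.rpow_le_rpow_of_nonpos hβ0 (by linarith) (by linarith)
          have h2 := Real.rpow_nonneg Real.pi_pos.le (p - 1)
          have h3 : (0 : ℝ) ≤ β ^ (p - 1) := by positivity
          have : ((2 * β) ^ (p - 1) - Real.pi ^ (p - 1)) / (1 - p) ≤ β ^ (p - 1) / κ :=
            div_le_div₀ h3 (by linarith) hκ (by linarith)
          linarith
      _ = 2 * β ^ p / (κ * β) := by
          rw [Real.rpow_sub hβ0, Real.rpow_one]; field_simp
      _ ≤ _ := by
          have := Real.rpow_pos_of_pos ha p
          gcongr
          simp only [M]; linarith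
  have e : 8 / κ * (M * (1 + Λ) / β) =
      2 * (2 * M / (κ * β)) + 4 * M * (1 + Λ) / (κ * β) * 1 + 4 * M * Λ / (κ * β) := by
    field_simp; ring
  rw [e]
  have : 0 ≤ 4 * M * Λ / (κ * β) := by positivity
  linarith

/-- The weight dominating the spectral density in the moment integrals. -/
def weight (p β x : ℝ) : ℝ := (|x| ^ p + β ^ p) / (β + |x|)

theorem intervalIntegrable_weight_mul_kern {p ε a β : ℝ} (hp : -1 < p) (hε : 0 < ε) (hβ : 0 < β)
    (c d : ℝ) : IntervalIntegrable (fun x => weight p β x * kern ε a x) volume c d := by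
  have : (fun x : ℝ => weight p β x * kern ε a x) =
      fun x => (|x| ^ p + β ^ p) * (1 / (β + |x|) * kern ε a x) := by
    funext x; unfold weight; ring
  rw [this]
  refine ((intervalIntegrable_abs_rpow hp c d).add intervalIntegrable_const).mul_continuousOn ?_
  refine (Continuous.mul (continuous_const.div (by fun_prop) ?_)
    (continuous_kern hε a)).continuousOn
  intro x
  positivity

theorem weight_nonneg {p β : ℝ} (hβ : 0 < β) (x : ℝ) : 0 ≤ weight p β x := by
  unfold weight; positivity

/-- Folding the negative half line onto the positive one only brings the centre closer, so the
kernel at |a| dominates both halves. The two terms of the weight are then the half-line estimate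
with exponents p and 0. -/
theorem integral_weight_mul_kern_le {p κ ε a β : ℝ} (hκ : 0 < κ) (hp : |p| ≤ 1 - κ) (hε : 0 < ε)
    (ha : a ≠ 0) (haβ : |a| ≤ β) (hβ : 2 * β ≤ Real.pi) :
    ∫ x in (-Real.pi)..Real.pi, weight p β x * kern ε a x ≤
      48 / κ * ((|a| ^ p + β ^ p) * (1 + Real.log (1 + β / ε)) / β) := by
  have hp' := abs_le.1 hp
  have hκ1 : κ ≤ 1 := by linarith [abs_nonneg p]
  have ha0 : 0 < |a| := abs_pos.2 ha
  have hβ0 : 0 < β := by linarith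
  have hβp := Real.rpow_pos_of_pos hβ0 p
  have hap := Real.rpow_pos_of_pos ha0 p
  have hint := intervalIntegrable_weight_mul_kern (a := a) (β := β) (by linarith : -1 < p) hε hβ0
  have hkern : ∀ x : ℝ, 0 ≤ x → kern ε a x ≤ kern ε |a| x ∧ kern ε a (-x) ≤ kern ε |a| x := by
    intro x hx
    unfold kern
    have h1 : |x - abs a| ≤ |x - a| := by
      have := abs_abs_sub_abs_le x a
      rwa [abs_of_nonneg hx] at this
    have h2 : |x - abs a| ≤ |-x - a| := by
      have := abs_abs_sub_abs_le (-x) a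
      rwa [abs_neg, abs_of_nonneg hx] at this
    constructor <;> · apply one_div_le_one_div_of_le (by positivity); linarith
  have i1 : IntervalIntegrable (fun x : ℝ => x ^ p / (β + x) * kern ε |a| x) volume 0 Real.pi := by
    have : (fun x : ℝ => x ^ p / (β + x) * kern ε |a| x) =
        fun x => x ^ p * (1 / (β + x) * kern ε |a| x) := by
      funext x; ring
    rw [this]
    refine (intervalIntegral.intervalIntegrable_rpow' (by linarith)).mul_continuousOn ?_
    refine ContinuousOn.mul (continuousOn_const.div (by fun_prop) ?_)
      (continuous_kern hε _).continuousOn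
    intro x hx
    rw [Set.uIcc_of_le Real.pi_pos.le] at hx
    have := hx.1
    positivity
  have i2 : IntervalIntegrable (fun x : ℝ => x ^ (0 : ℝ) / (β + x) * kern ε |a| x)
      volume 0 Real.pi := by
    refine ContinuousOn.intervalIntegrable ?_
    refine ContinuousOn.mul (ContinuousOn.div (by simp only [Real.rpow_zero]; fun_prop)
      (by fun_prop) ?_) (continuous_kern hε _).continuousOn
    intro x hx
    rw [Set.uIcc_of_le Real.pi_pos.le] at hx
    have := hx.1
    positivity
  calc ∫ x in (-Real.pi)..Real.pi, weight p β x * kern ε a x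
      = ∫ x in (0 : ℝ)..Real.pi,
          (weight p β x * kern ε a x + weight p β (-x) * kern ε a (-x)) :=
        integral_symm_eq Real.pi_pos.le (hint _ _)
    _ ≤ ∫ x in (0 : ℝ)..Real.pi, (2 * (x ^ p / (β + x) * kern ε |a| x) +
          2 * β ^ p * (x ^ (0 : ℝ) / (β + x) * kern ε |a| x)) := by
        refine intervalIntegral.integral_mono_on Real.pi_pos.le ?_
          ((i1.const_mul _).add (i2.const_mul _)) ?_
        · refine (hint _ _).add ?_
          have := (hint 0 (-Real.pi)).comp_sub_left 0
          simpa using this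
        · intro x hx
          have hw := weight_nonneg (p := p) hβ0 x
          have e : weight p β (-x) = weight p β x := by simp [weight]
          rw [e]
          obtain ⟨h1, h2⟩ := hkern x hx.1
          calc _ ≤ weight p β x * kern ε |a| x + weight p β x * kern ε |a| x := by gcongr
            _ = _ := by
              simp only [weight, abs_of_nonneg hx.1, Real.rpow_zero]
              ring
    _ = 2 * (∫ x in (0 : ℝ)..Real.pi, x ^ p / (β + x) * kern ε |a| x) +
          2 * β ^ p * (∫ x in (0 : ℝ)..Real.pi, x ^ (0 : ℝ) / (β + x) * kern ε |a| x) := by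
        rw [intervalIntegral.integral_add (i1.const_mul _) (i2.const_mul _),
          intervalIntegral.integral_const_mul, intervalIntegral.integral_const_mul]
    _ ≤ 2 * (8 / κ * ((|a| ^ p + β ^ p) * (1 + Real.log (1 + β / ε)) / β)) +
          2 * β ^ p * (8 / κ * ((|a| ^ (0 : ℝ) + β ^ (0 : ℝ)) *
            (1 + Real.log (1 + β / ε)) / β)) := by
        have h1 := integral_rpow_mul_kern_le hκ hp hε ha0 haβ hβ
        have h2 := integral_rpow_mul_kern_le (p := 0) hκ (by simp; linarith) hε ha0 haβ hβ
        gcongr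
    -- The exponent 0 contributes |a|^0 + β^0 = 2, so β^p carries 16 + 32 = 48 but |a|^p only 16;
    -- the subtracted term is this slack.
    _ = 48 / κ * ((|a| ^ p + β ^ p) * (1 + Real.log (1 + β / ε)) / β) -
          32 / κ * (|a| ^ p * (1 + Real.log (1 + β / ε)) / β) := by
        simp only [Real.rpow_zero]; ring
    _ ≤ _ := by
        have hΛ : 0 ≤ Real.log (1 + β / ε) := Real.log_nonneg (by
          have : 0 < β / ε := by positivity
          linarith)
        have : 0 ≤ 32 / κ * (|a| ^ p * (1 + Real.log (1 + β / ε)) / β) := by positivity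
        linarith

/-! ### L¹ modulus of continuity of |x|^p. -/

theorem intervalIntegrable_shift {p : ℝ} (hp : -1 < p) (h a b : ℝ) :
    IntervalIntegrable (fun x : ℝ => |x + h| ^ p) volume a b := by
  have := (intervalIntegrable_abs_rpow hp (a + h) (b + h)).comp_add_right h
  simpa using this

/-- For x > 0 the increment has a constant sign, that of p, so the absolute value leaves the
integral, which telescopes to the pieces over [A, A+h] and [0, h]. -/
theorem integral_abs_shift_sub_le_half {p κ h A : ℝ} (hκ : 0 < κ) (hp : |p| ≤ 1 - κ) (hh : 0 < h)
    (hA : h ≤ A) :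
    ∫ x in (0 : ℝ)..A, |(|x + h| ^ p - |x| ^ p)| ≤ 4 / κ * (h * (h ^ p + A ^ p)) := by
  have hp' := abs_le.1 hp
  have hκ1 : κ ≤ 1 := by linarith [abs_nonneg p]
  have hp1 : -1 < p := by linarith
  have hA0 : 0 < A := by linarith
  have j1 := intervalIntegrable_shift hp1 h
  have j2 := intervalIntegrable_abs_rpow hp1
  have hhp := Real.rpow_pos_of_pos hh p
  have hAp := Real.rpow_pos_of_pos hA0 p
  have habs : ∫ x in (0 : ℝ)..A, |(|x + h| ^ p - |x| ^ p)| ≤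
      |∫ x in (0 : ℝ)..A, (|x + h| ^ p - |x| ^ p)| := by
    rcases le_total 0 p with h0 | h0
    · refine le_trans (le_of_eq ?_) (le_abs_self _)
      refine intervalIntegral.integral_congr fun x hx => ?_
      rw [Set.uIcc_of_le hA0.le] at hx
      have : |x| ^ p ≤ |x + h| ^ p := by
        rw [abs_of_nonneg hx.1, abs_of_nonneg (by linarith [hx.1])]
        exact Real.rpow_le_rpow hx.1 (by linarith) h0
      exact abs_of_nonneg (by linarith)
    · refine le_trans (le_of_eq ?_) (neg_le_abs _)
      rw [← intervalIntegral.integral_neg]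
      -- The half-open interval excludes x = 0, where 0^p = 0 for p < 0 would break the comparison.
      refine intervalIntegral.integral_congr_ae (Filter.Eventually.of_forall fun x hx => ?_)
      rw [Set.uIoc_of_le hA0.le] at hx
      have : |x + h| ^ p ≤ |x| ^ p := by
        rw [abs_of_pos hx.1, abs_of_nonneg (by linarith [hx.1])]
        exact Real.rpow_le_rpow_of_nonpos hx.1 (by linarith) h0
      exact abs_of_nonpos (by linarith)
  have e : ∫ x in (0 : ℝ)..A, (|x + h| ^ p - |x| ^ p) =
      (∫ x in A..(A + h), |x| ^ p) - ∫ x in (0 : ℝ)..h, |x| ^ p := by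
    rw [intervalIntegral.integral_sub (j1 _ _) (j2 _ _),
      intervalIntegral.integral_comp_add_right (fun x => |x| ^ p), zero_add]
    have h1 := intervalIntegral.integral_add_adjacent_intervals (j2 0 h) (j2 h (A + h))
    have h2 := intervalIntegral.integral_add_adjacent_intervals (j2 0 A) (j2 A (A + h))
    linarith
  have b1 : ∫ x in (0 : ℝ)..h, |x| ^ p ≤ h * h ^ p / κ := by
    have h1 := integral_rpow_zero_le hκ hp hh.le
    have h2 : ∫ x in (0 : ℝ)..h, |x| ^ p = ∫ x in (0 : ℝ)..h, x ^ p := by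
      refine intervalIntegral.integral_congr fun x hx => ?_
      rw [Set.uIcc_of_le hh.le] at hx
      simp only [abs_of_nonneg hx.1]
    rw [h2]
    refine h1.trans (le_of_eq ?_)
    rw [Real.rpow_add hh, Real.rpow_one]; ring
  have b2 : ∫ x in A..(A + h), |x| ^ p ≤ h * (2 * (A ^ p + A ^ p)) := by
    calc _ ≤ ∫ x in A..(A + h), 2 * (A ^ p + A ^ p) := by
          refine intervalIntegral.integral_mono_on (by linarith) (j2 _ _)
            intervalIntegrable_const ?_
          intro x hx
          have hx0 : 0 < x := by linarith [hx.1]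
          rw [abs_of_pos hx0]
          exact rpow_le_two_mul_add (by linarith) hA0 hA0 (by linarith [hx.1])
            (by linarith [hx.2])
      _ = _ := by simp; ring
  have b2' : ∫ x in A..(A + h), |x| ^ p ≤ 4 * (h * A ^ p) / κ := by
    refine b2.trans ?_
    rw [le_div_iff₀ hκ]
    have : 0 < h * A ^ p := by positivity
    nlinarith
  have p1 : 0 ≤ ∫ x in (0 : ℝ)..h, |x| ^ p :=
    intervalIntegral.integral_nonneg hh.le fun x _ => by positivity
  have p2 : 0 ≤ ∫ x in A..(A + h), |x| ^ p :=
    intervalIntegral.integral_nonneg (by linarith) fun x _ => by positivity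
  refine habs.trans ?_
  rw [e]
  have e2 : 4 / κ * (h * (h ^ p + A ^ p)) = 4 * (h * A ^ p) / κ + 4 * (h * h ^ p / κ) := by ring
  have p3 : 0 ≤ h * h ^ p / κ := by positivity
  have p4 : 0 ≤ 4 * (h * A ^ p) / κ := by positivity
  rw [e2, abs_le]
  constructor <;> linarith

/-- The reflection x ↦ -x-h preserves the integrand and carries [-A, -h] into [0, A]. On [-h, 0],
between the two singularities, the powers are integrated separately. -/
theorem integral_abs_shift_sub_le {p κ h A : ℝ} (hκ : 0 < κ) (hp : |p| ≤ 1 - κ) (hh : 0 < h)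
    (hA : h ≤ A) :
    ∫ x in (-A)..A, |(|x + h| ^ p - |x| ^ p)| ≤ 10 / κ * (h * (h ^ p + A ^ p)) := by
  have hp' := abs_le.1 hp
  have hp1 : -1 < p := by linarith
  have hA0 : 0 < A := by linarith
  have hhp := Real.rpow_pos_of_pos hh p
  have hAp := Real.rpow_pos_of_pos hA0 p
  have j1 := intervalIntegrable_shift hp1 h
  have j2 := intervalIntegrable_abs_rpow hp1
  have j3 := intervalIntegrable_shift hp1 (-h)
  have j : ∀ a b : ℝ, IntervalIntegrable (fun x : ℝ => |(|x + h| ^ p - |x| ^ p)|) volume a b :=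
    fun a b => ((j1 a b).sub (j2 a b)).abs
  have hhalf := integral_abs_shift_sub_le_half hκ hp hh hA
  rw [← intervalIntegral.integral_add_adjacent_intervals (j (-A) (-h)) (j (-h) A),
    ← intervalIntegral.integral_add_adjacent_intervals (j (-h) 0) (j 0 A)]
  have b1 : ∫ x in (-A)..(-h), |(|x + h| ^ p - |x| ^ p)| ≤
      ∫ x in (0 : ℝ)..A, |(|x + h| ^ p - |x| ^ p)| := by
    rw [← intervalIntegral.integral_comp_neg (fun x : ℝ => |(|x + h| ^ p - |x| ^ p)|)]
    have e : ∀ x : ℝ, |(|-x + h| ^ p - |-x| ^ p)| = |(|(x - h) + h| ^ p - |x - h| ^ p)| := by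
      intro x
      rw [abs_neg, show -x + h = -(x - h) by ring, abs_neg, sub_add_cancel, abs_sub_comm]
    simp_rw [e]
    rw [intervalIntegral.integral_comp_sub_right (fun x => |(|x + h| ^ p - |x| ^ p)|) h, sub_self]
    exact intervalIntegral.integral_mono_interval le_rfl (by linarith) (by linarith)
      (Filter.Eventually.of_forall fun x => abs_nonneg _) (j 0 A)
  have b0 : ∫ x in (0 : ℝ)..h, |x| ^ p ≤ h * h ^ p / κ := by
    have h1 := integral_rpow_zero_le hκ hp hh.le
    have h2 : ∫ x in (0 : ℝ)..h, |x| ^ p = ∫ x in (0 : ℝ)..h, x ^ p := by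
      refine intervalIntegral.integral_congr fun x hx => ?_
      rw [Set.uIcc_of_le hh.le] at hx
      simp only [abs_of_nonneg hx.1]
    rw [h2]
    refine h1.trans (le_of_eq ?_)
    rw [Real.rpow_add hh, Real.rpow_one]; ring
  have b2 : ∫ x in (-h)..0, |(|x + h| ^ p - |x| ^ p)| ≤ 2 * (h * h ^ p / κ) := by
    calc _ ≤ ∫ x in (-h)..0, (|x + h| ^ p + |x| ^ p) := by
          refine intervalIntegral.integral_mono_on (by linarith) (j _ _)
            ((j1 _ _).add (j2 _ _)) fun x _ => ?_
          have h1 : 0 ≤ |x + h| ^ p := by positivity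
          have h2 : 0 ≤ |x| ^ p := by positivity
          rw [abs_le]; constructor <;> linarith
      _ = 2 * ∫ x in (0 : ℝ)..h, |x| ^ p := by
          rw [intervalIntegral.integral_add (j1 _ _) (j2 _ _),
            intervalIntegral.integral_comp_add_right (fun x => |x| ^ p)]
          have := intervalIntegral.integral_comp_neg (a := 0) (b := h) (fun x : ℝ => |x| ^ p)
          simp only [abs_neg, neg_zero] at this
          rw [← this, neg_add_cancel, zero_add]; ring
      _ ≤ _ := by linarith
  have e2 : 10 / κ * (h * (h ^ p + A ^ p)) =
      2 * (4 / κ * (h * (h ^ p + A ^ p))) + 2 * (h * h ^ p / κ) + 2 * (h * A ^ p / κ) := by ring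
  have p4 : 0 ≤ h * A ^ p / κ := by positivity
  rw [e2]
  linarith

/-! ### Dirichlet kernels and their products. -/

/-- `∑_{t=1}^n e^{itx}`. -/
def dirichlet (n : ℕ) (x : ℝ) : ℂ :=
  ∑ t ∈ Finset.Icc 1 n, Complex.exp (Complex.I * (((t : ℝ) * x : ℝ) : ℂ))

theorem norm_exp_I_mul (x : ℝ) : ‖Complex.exp (Complex.I * (x : ℂ))‖ = 1 := by
  rw [mul_comm]; exact Complex.norm_exp_ofReal_mul_I x

theorem norm_exp_I_mul_sub_le (x y : ℝ) :
    ‖Complex.exp (Complex.I * (x : ℂ)) - Complex.exp (Complex.I * (y : ℂ))‖ ≤ |x - y| := by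
  have : Complex.exp (Complex.I * (x : ℂ)) - Complex.exp (Complex.I * (y : ℂ)) =
      Complex.exp (Complex.I * (y : ℂ)) * (Complex.exp (Complex.I * ((x - y : ℝ) : ℂ)) - 1) := by
    rw [mul_sub, ← Complex.exp_add, mul_one]; congr 2; push_cast; ring
  rw [this, norm_mul, norm_exp_I_mul, one_mul]
  exact Real.norm_exp_I_mul_ofReal_sub_one_le

/-- A point of [-π, π] and a centre in [-π/2, π/2] differ by at most 3π/2, short of the next zero
2π; this is what k ≤ n/4 secures. Jordan's inequality is applied at y/2 or at π - y/2. -/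
theorem abs_le_norm_exp_sub_one {x : ℝ} (hx : |x| ≤ 3 * Real.pi / 2) :
    |x| ≤ 5 * ‖Complex.exp (Complex.I * (x : ℂ)) - 1‖ := by
  rw [Complex.norm_exp_I_mul_ofReal_sub_one]
  have hpi := Real.pi_lt_d2
  have hpi3 := Real.pi_gt_three
  have h1 : ‖2 * Real.sin (x / 2)‖ = 2 * |Real.sin (|x| / 2)| := by
    rw [norm_mul, Real.norm_eq_abs, Real.norm_eq_abs, abs_of_pos (by norm_num : (0:ℝ) < 2)]
    rcases abs_cases x with ⟨h, _⟩ | ⟨h, _⟩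
    · rw [h]
    · rw [h, neg_div, Real.sin_neg, abs_neg]
  rw [h1]
  have h0 := abs_nonneg x
  set y := |x| with hy
  rcases le_total y Real.pi with h | h
  · have h2 : 2 / Real.pi * (y / 2) ≤ Real.sin (y / 2) :=
      Real.mul_le_sin (by linarith) (by linarith)
    have h3 : y / 4 ≤ 2 / Real.pi * (y / 2) := by
      have : 1 / 4 ≤ 1 / Real.pi := one_div_le_one_div_of_le Real.pi_pos (by linarith)
      calc y / 4 = 1 / 4 * y := by ring
        _ ≤ 1 / Real.pi * y := by gcongr
        _ = _ := by ring
    have := le_abs_self (Real.sin (y / 2))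
    linarith
  · have h2 : 2 / Real.pi * (Real.pi - y / 2) ≤ Real.sin (Real.pi - y / 2) :=
      Real.mul_le_sin (by linarith) (by linarith)
    rw [Real.sin_pi_sub] at h2
    have h3 : 1 / 2 ≤ 2 / Real.pi * (Real.pi - y / 2) := by
      rw [div_mul_eq_mul_div, le_div_iff₀ Real.pi_pos]
      linarith
    have := le_abs_self (Real.sin (y / 2))
    linarith

theorem exp_I_mul_nat (t : ℕ) (x : ℝ) :
    Complex.exp (Complex.I * (((t : ℝ) * x : ℝ) : ℂ)) =
      Complex.exp (Complex.I * (x : ℂ)) ^ t := by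
  rw [← Complex.exp_nat_mul]; congr 1; push_cast; ring

theorem exp_sub_one_mul_dirichlet (n : ℕ) (x : ℝ) :
    (Complex.exp (Complex.I * (x : ℂ)) - 1) * dirichlet n x =
      Complex.exp (Complex.I * ((((n + 1 : ℕ) : ℝ) * x : ℝ) : ℂ)) -
        Complex.exp (Complex.I * (x : ℂ)) := by
  unfold dirichlet
  simp only [exp_I_mul_nat]
  induction n with
  | zero => simp
  | succ n ih =>
    rw [Finset.sum_Icc_succ_top (by omega), mul_add, ih]; ring

theorem norm_dirichlet_le (n : ℕ) (x : ℝ) : ‖dirichlet n x‖ ≤ n := by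
  unfold dirichlet
  refine (norm_sum_le _ _).trans ?_
  simp [Complex.norm_exp]

theorem norm_dirichlet_sub_le (n : ℕ) (x y : ℝ) :
    ‖dirichlet n x - dirichlet n y‖ ≤ n * (n * |x - y|) := by
  unfold dirichlet
  rw [← Finset.sum_sub_distrib]
  refine (norm_sum_le _ _).trans ?_
  calc _ ≤ ∑ t ∈ Finset.Icc 1 n, (n * |x - y|) := by
        refine Finset.sum_le_sum fun t ht => (norm_exp_I_mul_sub_le _ _).trans ?_
        rw [← mul_sub, abs_mul, Nat.abs_cast]
        have : (t : ℝ) ≤ n := by exact_mod_cast (Finset.mem_Icc.1 ht).2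
        gcongr
    _ = _ := by simp

/-- Sum of the trivial bound ‖D‖ ≤ n and the geometric-series bound: 11 = 1 + 5·2. -/
theorem norm_dirichlet_le_kern {n : ℕ} (hn : 1 ≤ n) {x : ℝ} (hx : |x| ≤ 3 * Real.pi / 2) :
    ‖dirichlet n x‖ ≤ 11 * (1 / (1 / n + |x|)) := by
  have hn' : (0 : ℝ) < n := by exact_mod_cast hn
  rw [mul_one_div, le_div_iff₀ (by positivity), mul_add]
  have h1 : ‖dirichlet n x‖ * (1 / n) ≤ 1 := by
    rw [mul_one_div, div_le_one hn']; exact norm_dirichlet_le n x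
  have h2 : ‖Complex.exp (Complex.I * (x : ℂ)) - 1‖ * ‖dirichlet n x‖ ≤ 2 := by
    rw [← norm_mul, exp_sub_one_mul_dirichlet]
    refine (norm_sub_le _ _).trans ?_
    rw [norm_exp_I_mul, norm_exp_I_mul]; norm_num
  have h3 := mul_le_mul_of_nonneg_left (abs_le_norm_exp_sub_one hx) (norm_nonneg (dirichlet n x))
  linarith

/-- The geometric-sum identities at x and y are subtracted, so only the base point x must avoid 2πℤ
and y is free. The constant is 21 = 1 + 5·4. -/
theorem norm_dirichlet_sub_le_kern {n : ℕ} (hn : 1 ≤ n) {x y : ℝ} (hx : |x| ≤ 3 * Real.pi / 2) :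
    ‖dirichlet n y - dirichlet n x‖ ≤ 21 * (n * |y - x|) * (1 / (1 / n + |x|)) := by
  have hn' : (0 : ℝ) < n := by exact_mod_cast hn
  have hn1 : (1 : ℝ) ≤ n := by exact_mod_cast hn
  rw [mul_one_div, le_div_iff₀ (by positivity), mul_add]
  have h1 : ‖dirichlet n y - dirichlet n x‖ * (1 / n) ≤ n * |y - x| := by
    rw [mul_one_div, div_le_iff₀ hn', mul_comm (_ * _) (n : ℝ)]; exact norm_dirichlet_sub_le n y x
  have h2 : ‖Complex.exp (Complex.I * (x : ℂ)) - 1‖ * ‖dirichlet n y - dirichlet n x‖ ≤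
      4 * (n * |y - x|) := by
    have e : (Complex.exp (Complex.I * (x : ℂ)) - 1) * (dirichlet n y - dirichlet n x) =
        (Complex.exp (Complex.I * ((((n + 1 : ℕ) : ℝ) * y : ℝ) : ℂ)) -
          Complex.exp (Complex.I * ((((n + 1 : ℕ) : ℝ) * x : ℝ) : ℂ))) -
        (Complex.exp (Complex.I * (y : ℂ)) - Complex.exp (Complex.I * (x : ℂ))) -
        (Complex.exp (Complex.I * (y : ℂ)) - Complex.exp (Complex.I * (x : ℂ))) *
          dirichlet n y := by
      have e1 := exp_sub_one_mul_dirichlet n x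
      have e2 := exp_sub_one_mul_dirichlet n y
      linear_combination e2 - e1
    have d := norm_exp_I_mul_sub_le y x
    have d1 := norm_exp_I_mul_sub_le (((n + 1 : ℕ) : ℝ) * y) (((n + 1 : ℕ) : ℝ) * x)
    rw [← mul_sub, abs_mul, Nat.abs_cast] at d1
    rw [← norm_mul, e]
    calc _ ≤ ((n + 1 : ℕ) : ℝ) * |y - x| + |y - x| + |y - x| * n := by
          refine (norm_sub_le _ _).trans (add_le_add ((norm_sub_le _ _).trans
            (add_le_add d1 d)) ?_)
          rw [norm_mul]
          exact mul_le_mul d (norm_dirichlet_le n y) (norm_nonneg _) (abs_nonneg _)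
      _ = (2 * n + 2) * |y - x| := by push_cast; ring
      _ ≤ (4 * n) * |y - x| := by gcongr; linarith
      _ = _ := by ring
  have h3 := mul_le_mul_of_nonneg_left (abs_le_norm_exp_sub_one hx)
    (norm_nonneg (dirichlet n y - dirichlet n x))
  linarith

theorem dirichlet_eq_zero {n : ℕ} {x : ℝ} {m : ℤ} (hx : x ≠ 0) (hx' : |x| ≤ 3 * Real.pi / 2)
    (h : (n : ℝ) * x = 2 * Real.pi * m) : dirichlet n x = 0 := by
  have h1 : Complex.exp (Complex.I * (x : ℂ)) - 1 ≠ 0 := by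
    intro h0
    have := abs_le_norm_exp_sub_one hx'
    rw [h0, norm_zero, mul_zero] at this
    exact hx (abs_nonpos_iff.1 this)
  have h2 := exp_sub_one_mul_dirichlet n x
  have h3 : Complex.exp (Complex.I * ((((n + 1 : ℕ) : ℝ) * x : ℝ) : ℂ)) =
      Complex.exp (Complex.I * (x : ℂ)) := by
    rw [Complex.exp_eq_exp_iff_exists_int]
    refine ⟨m, ?_⟩
    have : (((n + 1 : ℕ) : ℝ) * x : ℝ) = x + 2 * Real.pi * m := by push_cast; linarith
    rw [this]; push_cast; ring
  rw [h3, sub_self] at h2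
  exact (mul_eq_zero.1 h2).resolve_left h1

@[fun_prop]
theorem continuous_dirichlet (n : ℕ) : Continuous (dirichlet n) := by
  unfold dirichlet; fun_prop

/-- The product of Dirichlet kernels `D(a - ω) D(ω - b)`. -/
def crossKernel (n : ℕ) (a b ω : ℝ) : ℂ := dirichlet n (a - ω) * dirichlet n (ω - b)

@[fun_prop]
theorem continuous_crossKernel (n : ℕ) (a b : ℝ) : Continuous (crossKernel n a b) := by
  unfold crossKernel; fun_prop

section bounds

variable {n : ℕ} {a b ω h : ℝ}

theorem abs_sub_le_of_abs_le (ha : |a| ≤ Real.pi / 2) (hω : |ω| ≤ Real.pi) :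
    |ω - a| ≤ 3 * Real.pi / 2 := by
  have := abs_sub ω a
  linarith

theorem norm_crossKernel_le (hn : 1 ≤ n) (ha : |a| ≤ Real.pi / 2) (hb : |b| ≤ Real.pi / 2)
    (hω : |ω| ≤ Real.pi) :
    ‖crossKernel n a b ω‖ ≤ 121 * (kern (1 / n) a ω * kern (1 / n) b ω) := by
  have h1 := norm_dirichlet_le_kern (x := a - ω) hn
    (by rw [abs_sub_comm]; exact abs_sub_le_of_abs_le ha hω)
  have h2 := norm_dirichlet_le_kern (x := ω - b) hn (abs_sub_le_of_abs_le hb hω)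
  rw [abs_sub_comm] at h1
  rw [crossKernel, norm_mul]
  calc _ ≤ (11 * kern (1 / n) a ω) * (11 * kern (1 / n) b ω) :=
        mul_le_mul h1 h2 (norm_nonneg _) ((norm_nonneg _).trans h1)
    _ = _ := by ring

/-- The bounds refer to the unshifted ω, so ω + h may leave [-π, π]. Constants: 95 = 11 + 21·4, 9025
= 95², 2226 = 21·95 + 11·21. -/
theorem norm_crossKernel_shift_le (hn : 1 ≤ n) (ha : |a| ≤ Real.pi / 2) (hb : |b| ≤ Real.pi / 2)
    (hω : |ω| ≤ Real.pi) (hh : n * |h| ≤ 4) :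
    ‖crossKernel n a b (ω + h)‖ ≤ 9025 * (kern (1 / n) a ω * kern (1 / n) b ω) ∧
    ‖crossKernel n a b (ω + h) - crossKernel n a b ω‖ ≤
      2226 * (n * |h|) * (kern (1 / n) a ω * kern (1 / n) b ω) := by
  have hε : (0 : ℝ) < 1 / n := by
    have : (0 : ℝ) < n := by exact_mod_cast hn
    positivity
  have ka := kern_pos hε a ω
  have kb := kern_pos hε b ω
  have hτ : 0 ≤ n * |h| := by positivity
  have hxa : |a - ω| ≤ 3 * Real.pi / 2 := by
    rw [abs_sub_comm]; exact abs_sub_le_of_abs_le ha hω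
  have hxb : |ω - b| ≤ 3 * Real.pi / 2 := abs_sub_le_of_abs_le hb hω
  have h1 : ‖dirichlet n (a - ω)‖ ≤ 11 * kern (1 / n) a ω := by
    have := norm_dirichlet_le_kern hn hxa
    rwa [abs_sub_comm] at this
  have h2 : ‖dirichlet n (ω - b)‖ ≤ 11 * kern (1 / n) b ω := norm_dirichlet_le_kern hn hxb
  have h3 : ‖dirichlet n (a - (ω + h)) - dirichlet n (a - ω)‖ ≤
      21 * (n * |h|) * kern (1 / n) a ω := by
    have := norm_dirichlet_sub_le_kern (y := a - (ω + h)) hn hxa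
    rwa [show a - (ω + h) - (a - ω) = -h by ring, abs_neg, abs_sub_comm a] at this
  have h4 : ‖dirichlet n (ω + h - b) - dirichlet n (ω - b)‖ ≤
      21 * (n * |h|) * kern (1 / n) b ω := by
    have := norm_dirichlet_sub_le_kern (y := ω + h - b) hn hxb
    rwa [show ω + h - b - (ω - b) = h by ring] at this
  have h5 : ‖dirichlet n (a - (ω + h))‖ ≤ 95 * kern (1 / n) a ω := by
    have := norm_le_norm_add_norm_sub' (dirichlet n (a - (ω + h))) (dirichlet n (a - ω))
    nlinarith
  have h6 : ‖dirichlet n (ω + h - b)‖ ≤ 95 * kern (1 / n) b ω := by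
    have := norm_le_norm_add_norm_sub' (dirichlet n (ω + h - b)) (dirichlet n (ω - b))
    nlinarith
  constructor
  · rw [crossKernel, norm_mul]
    calc _ ≤ (95 * kern (1 / n) a ω) * (95 * kern (1 / n) b ω) :=
          mul_le_mul h5 h6 (norm_nonneg _) (by positivity)
      _ = _ := by ring
  · have e : crossKernel n a b (ω + h) - crossKernel n a b ω =
        (dirichlet n (a - (ω + h)) - dirichlet n (a - ω)) * dirichlet n (ω + h - b) +
        dirichlet n (a - ω) * (dirichlet n (ω + h - b) - dirichlet n (ω - b)) := by
      simp only [crossKernel]; ring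
    rw [e]
    refine (norm_add_le _ _).trans ?_
    rw [norm_mul, norm_mul]
    calc _ ≤ (21 * (n * |h|) * kern (1 / n) a ω) * (95 * kern (1 / n) b ω) +
          (11 * kern (1 / n) a ω) * (21 * (n * |h|) * kern (1 / n) b ω) :=
          add_le_add (mul_le_mul h3 h6 (norm_nonneg _) (by positivity))
            (mul_le_mul h1 h4 (norm_nonneg _) (by positivity))
      _ = _ := by ring

end bounds

/-! ### Orthogonality and the spectral formula for the moments. -/

theorem integral_exp_int (m : ℤ) :
    ∫ ω in (-Real.pi)..Real.pi, Complex.exp (Complex.I * (((m : ℝ) * ω : ℝ) : ℂ)) =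
      if m = 0 then (2 * Real.pi : ℂ) else 0 := by
  split_ifs with h
  · subst h; simp; ring
  · have hc : Complex.I * (m : ℂ) ≠ 0 := mul_ne_zero Complex.I_ne_zero (by exact_mod_cast h)
    have e : ∀ ω : ℝ, Complex.exp (Complex.I * (((m : ℝ) * ω : ℝ) : ℂ)) =
        Complex.exp (Complex.I * (m : ℂ) * (ω : ℂ)) := by
      intro ω; congr 1; push_cast; ring
    simp_rw [e]
    rw [integral_exp_mul_complex hc]
    have : Complex.exp (Complex.I * (m : ℂ) * (Real.pi : ℂ)) =
        Complex.exp (Complex.I * (m : ℂ) * ((-Real.pi : ℝ) : ℂ)) := by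
      rw [Complex.exp_eq_exp_iff_exists_int]
      exact ⟨m, by push_cast; ring⟩
    rw [this, sub_self, zero_div]

/-- The character `e^{iNω}`. -/
def char (N : ℕ) (ω : ℝ) : ℂ := Complex.exp (Complex.I * (((N : ℝ) * ω : ℝ) : ℂ))

@[fun_prop]
theorem continuous_char (N : ℕ) : Continuous (char N) := by
  unfold char; fun_prop

theorem norm_char (N : ℕ) (ω : ℝ) : ‖char N ω‖ = 1 := norm_exp_I_mul _

theorem char_mul_crossKernel (N n : ℕ) (a b ω : ℝ) :
    char N ω * crossKernel n a b ω =
      ∑ s ∈ Finset.Icc 1 n, ∑ t ∈ Finset.Icc 1 n,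
        Complex.exp (Complex.I * (((s : ℝ) * a : ℝ) : ℂ)) *
        Complex.exp (Complex.I * (((t : ℝ) * (-b) : ℝ) : ℂ)) *
        Complex.exp (Complex.I * (((((t : ℤ) + N - s : ℤ) : ℝ) * ω : ℝ) : ℂ)) := by
  unfold char crossKernel dirichlet
  rw [Finset.sum_mul_sum, Finset.mul_sum]
  refine Finset.sum_congr rfl fun s _ => ?_
  rw [Finset.mul_sum]
  refine Finset.sum_congr rfl fun t _ => ?_
  rw [← Complex.exp_add, ← Complex.exp_add, ← Complex.exp_add, ← Complex.exp_add]
  congr 1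
  push_cast
  ring

theorem integral_char_mul_crossKernel (N n : ℕ) (a b : ℝ) :
    ∫ ω in (-Real.pi)..Real.pi, char N ω * crossKernel n a b ω =
      ∑ s ∈ Finset.Icc 1 n, ∑ t ∈ Finset.Icc 1 n,
        Complex.exp (Complex.I * (((s : ℝ) * a : ℝ) : ℂ)) *
        Complex.exp (Complex.I * (((t : ℝ) * (-b) : ℝ) : ℂ)) *
        (if (t : ℤ) + N - s = 0 then (2 * Real.pi : ℂ) else 0) := by
  simp_rw [char_mul_crossKernel]
  rw [intervalIntegral.integral_finsetSum
    (fun s _ => Continuous.intervalIntegrable (by fun_prop) _ _)]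
  refine Finset.sum_congr rfl fun s _ => ?_
  rw [intervalIntegral.integral_finsetSum
    (fun s _ => Continuous.intervalIntegrable (by fun_prop) _ _)]
  refine Finset.sum_congr rfl fun t _ => ?_
  rw [intervalIntegral.integral_const_mul, integral_exp_int]

/-- Every frequency t + N - s is at least 1, since t - s ≥ 1 - n. -/
theorem integral_char_mul_crossKernel_of_le {N n : ℕ} (h : n ≤ N) (a b : ℝ) :
    ∫ ω in (-Real.pi)..Real.pi, char N ω * crossKernel n a b ω = 0 := by
  rw [integral_char_mul_crossKernel]
  refine Finset.sum_eq_zero fun s hs => Finset.sum_eq_zero fun t ht => ?_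
  rw [Finset.mem_Icc] at hs ht
  rw [if_neg (by omega), mul_zero]

theorem integral_char_zero_mul_crossKernel (n : ℕ) (a b : ℝ) :
    ∫ ω in (-Real.pi)..Real.pi, char 0 ω * crossKernel n a b ω =
      2 * Real.pi * dirichlet n (a - b) := by
  rw [integral_char_mul_crossKernel, dirichlet, Finset.mul_sum]
  refine Finset.sum_congr rfl fun s hs => ?_
  rw [Finset.sum_eq_single s]
  · rw [if_pos (by simp), ← Complex.exp_add, mul_comm]
    congr 2
    push_cast; ring
  · intro t _ hts
    rw [if_neg (by omega), mul_zero]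
  · intro h; exact absurd hs h

section moments

variable {Ω : Type*} [MeasurableSpace Ω] {P : Measure Ω} {X : ℤ → Ω → ℝ} {f : ℝ → ℝ}

theorem HasSpectralDensity.integrable_mul (hX : HasSpectralDensity P X f) (s t : ℤ) :
    Integrable (fun x => X s x * X t x) P := (hX.memLp s).integrable_mul (hX.memLp t)

theorem HasSpectralDensity.intervalIntegrable (hX : HasSpectralDensity P X f) :
    IntervalIntegrable f volume (-Real.pi) Real.pi := by
  rw [intervalIntegrable_iff_integrableOn_Icc_of_le (by linarith [Real.pi_pos])]
  exact hX.density_integrable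

theorem HasSpectralDensity.integral_mul_eq [IsProbabilityMeasure P]
    (hX : HasSpectralDensity P X f) (s t : ℤ) :
    ((∫ x, X s x * X t x ∂P : ℝ) : ℂ) =
      (∫ ω in (-Real.pi)..Real.pi,
        Complex.exp (Complex.I * ((((t - s : ℤ) : ℝ) * ω : ℝ) : ℂ)) * ((f ω : ℝ) : ℂ)) +
      ((∫ x, X 0 x ∂P : ℝ) : ℂ) ^ 2 := by
  have h := ProbabilityTheory.covariance_eq_sub (hX.memLp s) (hX.memLp t)
  rw [hX.mean_eq s 0, hX.mean_eq t 0] at h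
  rw [← hX.covariance_eq s t, h]
  simp only [Pi.mul_apply]
  push_cast; ring

/-- E[X_s X_t] is the covariance plus the squared mean; summed over s, the mean term carries the
factor D(a) = 0, so the process need not be centred. -/
theorem HasSpectralDensity.integral_dft_mul_dft [IsProbabilityMeasure P]
    (hX : HasSpectralDensity P X f) {n : ℕ} (ℓ : ℕ)
    {a b : ℝ} (ha : dirichlet n a = 0) :
    ∫ x, dft X 0 n a x * dft X ℓ n (-b) x ∂P =
      ((2 * Real.pi * n : ℝ) : ℂ)⁻¹ * ∫ ω in (-Real.pi)..Real.pi,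
        (f ω : ℂ) * (char (ℓ * n) ω * crossKernel n a b ω) := by
  set c : ℂ := (((Real.sqrt (2 * Real.pi * (n : ℝ)))⁻¹ : ℝ) : ℂ) with hc
  have hcc : c * c = ((2 * Real.pi * n : ℝ) : ℂ)⁻¹ := by
    rw [hc, ← Complex.ofReal_mul, ← mul_inv, Real.mul_self_sqrt (by positivity)]
    push_cast; rfl
  set e : ℕ → ℝ → ℂ := fun t ω => Complex.exp (Complex.I * (((t : ℝ) * ω : ℝ) : ℂ)) with he
  have e1 : ∀ x, dft X 0 n a x * dft X ℓ n (-b) x =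
      c * c * ∑ s ∈ Finset.Icc 1 n, ∑ t ∈ Finset.Icc 1 n, (e s a * e t (-b)) *
        ((X ((s + 0 * n : ℕ) : ℤ) x * X ((t + ℓ * n : ℕ) : ℤ) x : ℝ) : ℂ) := by
    intro x
    unfold dft
    rw [mul_mul_mul_comm, Finset.sum_mul_sum]
    congr 1
    refine Finset.sum_congr rfl fun s _ => Finset.sum_congr rfl fun t _ => ?_
    simp only [he]
    push_cast; ring
  have hint : ∀ s t : ℕ, Integrable (fun x => (e s a * e t (-b)) *
        ((X ((s + 0 * n : ℕ) : ℤ) x * X ((t + ℓ * n : ℕ) : ℤ) x : ℝ) : ℂ)) P :=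
    fun s t => ((hX.integrable_mul _ _).ofReal).const_mul _
  simp_rw [e1]
  rw [integral_const_mul, hcc]
  congr 1
  rw [integral_finsetSum _ (fun s _ => integrable_finsetSum _ fun t _ => hint s t)]
  have e2 : ∀ s ∈ Finset.Icc 1 n, ∫ x, ∑ t ∈ Finset.Icc 1 n, (e s a * e t (-b)) *
        ((X ((s + 0 * n : ℕ) : ℤ) x * X ((t + ℓ * n : ℕ) : ℤ) x : ℝ) : ℂ) ∂P =
      (∑ t ∈ Finset.Icc 1 n, ∫ ω in (-Real.pi)..Real.pi, e s a * e t (-b) *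
        Complex.exp (Complex.I * (((((t : ℤ) + (ℓ * n : ℕ) - s : ℤ) : ℝ) * ω : ℝ) : ℂ)) * (f ω : ℂ)) +
      e s a * (dirichlet n (-b) * ((∫ x, X 0 x ∂P : ℝ) : ℂ) ^ 2) := by
    intro s _
    rw [integral_finsetSum _ fun t _ => hint s t, dirichlet, Finset.sum_mul, Finset.mul_sum,
      ← Finset.sum_add_distrib]
    refine Finset.sum_congr rfl fun t _ => ?_
    rw [integral_const_mul, integral_complex_ofReal, hX.integral_mul_eq, mul_add]
    congr 1
    · rw [← intervalIntegral.integral_const_mul]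
      refine intervalIntegral.integral_congr fun ω _ => ?_
      rw [mul_assoc (e s a * e t (-b))]
      congr 6
      push_cast; ring
    · simp only [he]; ring
  rw [Finset.sum_congr rfl e2, Finset.sum_add_distrib, ← Finset.sum_mul]
  have e3 : ∑ s ∈ Finset.Icc 1 n, e s a = 0 := ha
  rw [e3, zero_mul, add_zero]
  have hf : IntervalIntegrable (fun ω => (f ω : ℂ)) volume (-Real.pi) Real.pi :=
    ⟨hX.intervalIntegrable.1.ofReal, hX.intervalIntegrable.2.ofReal⟩
  have hi : ∀ s t : ℕ, IntervalIntegrable (fun ω => e s a * e t (-b) *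
        Complex.exp (Complex.I * (((((t : ℤ) + (ℓ * n : ℕ) - s : ℤ) : ℝ) * ω : ℝ) : ℂ)) * (f ω : ℂ))
        volume (-Real.pi) Real.pi := by
    intro s t
    exact hf.continuousOn_mul (Continuous.continuousOn (by fun_prop))
  rw [Finset.sum_congr rfl fun s _ => (intervalIntegral.integral_finsetSum
    fun t _ => hi s t).symm, ← intervalIntegral.integral_finsetSum]
  · refine intervalIntegral.integral_congr fun ω _ => ?_
    rw [char_mul_crossKernel, mul_comm ((f ω : ℝ) : ℂ), Finset.sum_mul]
    refine Finset.sum_congr rfl fun s _ => ?_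
    rw [Finset.sum_mul]
  · intro s _
    have := IntervalIntegrable.sum (Finset.Icc 1 n) (f := fun t => fun ω => e s a * e t (-b) *
        Complex.exp (Complex.I * (((((t : ℤ) + (ℓ * n : ℕ) - s : ℤ) : ℝ) * ω : ℝ) : ℂ)) * (f ω : ℂ))
        (fun t _ => hi s t)
    refine this.congr ?_
    intro ω _
    simp

end moments

theorem conj_dft {Ω : Type*} (X : ℤ → Ω → ℝ) (ℓ n : ℕ) (ω : ℝ) (x : Ω) :
    (starRingEnd ℂ) (dft X ℓ n ω x) = dft X ℓ n (-ω) x := by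
  unfold dft
  rw [map_mul, Complex.conj_ofReal, map_sum]
  congr 1
  refine Finset.sum_congr rfl fun t _ => ?_
  rw [map_mul, Complex.conj_ofReal, ← Complex.exp_conj, map_mul, Complex.conj_I,
    Complex.conj_ofReal]
  congr 2
  push_cast; ring

/-! ### Regularity of the spectral density. -/

section density

variable {μ ν d : ℝ} {φ : ℝ → ℝ}

theorem memoryDensity_mem_Icc (ω : ℝ) (hφ : LocalLipschitz μ ν φ) (hω : |ω| ≤ Real.pi) :
    0 ≤ memoryDensity d φ ω ∧ memoryDensity d φ ω ≤ μ * φ 0 * |ω| ^ (-2 * d) := by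
  have hm : ω ∈ Set.Icc (-Real.pi) Real.pi := abs_le.1 hω
  have h1 := hφ.nonneg ω hm
  have h2 := hφ.le_mul ω hm
  unfold memoryDensity
  have h3 : 0 ≤ |ω| ^ (-2 * d) := by positivity
  exact ⟨by positivity, by nlinarith⟩

theorem le_memoryDensity {ω : ℝ} (h : φ 0 ≤ μ * φ ω) :
    φ 0 * |ω| ^ (-2 * d) ≤ μ * memoryDensity d φ ω := by
  unfold memoryDensity
  have h3 : 0 ≤ |ω| ^ (-2 * d) := by positivity
  nlinarith

/-- Evenness is hidden in the Hölder condition: at ω and -ω its right side is a multiple of 0^ν = 0.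
-/
theorem memoryDensity_neg (hφ : LocalLipschitz μ ν φ) (hν : 0 < ν) {ω : ℝ}
    (hω : |ω| ≤ Real.pi) : memoryDensity d φ (-ω) = memoryDensity d φ ω := by
  rcases eq_or_ne ω 0 with rfl | h0
  · simp
  have hm : ω ∈ Set.Icc (-Real.pi) Real.pi := abs_le.1 hω
  have hm' : -ω ∈ Set.Icc (-Real.pi) Real.pi := abs_le.1 (by rwa [abs_neg])
  have := hφ.holder (-ω) hm' ω hm (neg_ne_zero.2 h0) h0
  rw [abs_neg, sub_self, abs_zero, Real.zero_rpow hν.ne', mul_zero] at this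
  have := sub_eq_zero.1 (abs_nonpos_iff.1 this)
  simp only [memoryDensity, abs_neg, this]

theorem memoryDensity_abs (hφ : LocalLipschitz μ ν φ) (hν : 0 < ν) {ω : ℝ}
    (hω : |ω| ≤ Real.pi) : memoryDensity d φ |ω| = memoryDensity d φ ω := by
  rcases abs_choice ω with h | h
  · rw [h]
  · rw [h, memoryDensity_neg hφ hν hω]

theorem abs_memoryDensity_sub_le (hφ : LocalLipschitz μ ν φ)
    (hd : |-2 * d| ≤ 1) {ω ω' : ℝ} (hω : |ω| ≤ Real.pi) (hω' : |ω'| ≤ Real.pi) (h0 : ω ≠ 0)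
    (h0' : ω' ≠ 0) :
    |memoryDensity d φ ω - memoryDensity d φ ω'| ≤
      2 * (μ * φ 0) * ((|ω| ^ (-2 * d) + |ω'| ^ (-2 * d)) * (|ω - ω'| / min |ω| |ω'|)) := by
  have hm : ω ∈ Set.Icc (-Real.pi) Real.pi := abs_le.1 hω
  have hm' : ω' ∈ Set.Icc (-Real.pi) Real.pi := abs_le.1 hω'
  have h1 := hφ.lipschitz ω hm ω' hm' h0 h0'
  have h2 := abs_rpow_sub_rpow_le hd (abs_pos.2 h0) (abs_pos.2 h0')
  have h3 : |(|ω| - |ω'|)| / min |ω| |ω'| ≤ |ω - ω'| / min |ω| |ω'| := by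
    have := abs_abs_sub_abs_le ω ω'
    have : 0 < min |ω| |ω'| := lt_min (abs_pos.2 h0) (abs_pos.2 h0')
    gcongr
  have h4 := hφ.nonneg ω hm
  have h5 := hφ.le_mul ω hm
  have g1 : 0 ≤ |ω| ^ (-2 * d) := by positivity
  have g2 : 0 ≤ |ω'| ^ (-2 * d) := by positivity
  have hr : 0 ≤ |ω - ω'| / min |ω| |ω'| := by positivity
  unfold memoryDensity
  generalize |ω| ^ (-2 * d) = g at *
  generalize |ω'| ^ (-2 * d) = g' at *
  generalize |ω - ω'| / min |ω| |ω'| = r at *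
  have e : g * φ ω - g' * φ ω' = (g - g') * φ ω + g' * (φ ω - φ ω') := by ring
  rw [e]
  calc _ ≤ |g - g'| * φ ω + g' * |φ ω - φ ω'| := by
        refine (abs_add_le _ _).trans ?_
        rw [abs_mul, abs_mul, abs_of_nonneg h4, abs_of_nonneg g2]
    _ ≤ ((g + g') * r) * (μ * φ 0) + g' * (μ * φ 0 * r) := by
        have : |g - g'| ≤ (g + g') * r := h2.trans (by gcongr)
        gcongr
    _ ≤ _ := by
        have : 0 ≤ μ * φ 0 := h4.trans h5
        have : 0 ≤ g * (μ * φ 0 * r) := by positivity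
        linarith

/-- Meant for ω near 0. The increment of the power is left unestimated because it is small only in
L¹, not pointwise. -/
theorem abs_memoryDensity_sub_le_holder (hφ : LocalLipschitz μ ν φ) (hν : 0 < ν)
    {ω h : ℝ} (hω : |ω| ≤ Real.pi) (hω' : |ω + h| ≤ Real.pi) (h0 : ω ≠ 0)
    (h0' : ω + h ≠ 0) (hh : 0 ≤ h) :
    |memoryDensity d φ (ω + h) - memoryDensity d φ ω| ≤
      μ * φ 0 * (|(|ω + h| ^ (-2 * d) - |ω| ^ (-2 * d))| + |ω| ^ (-2 * d) * h ^ ν) := by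
  have hm : ω ∈ Set.Icc (-Real.pi) Real.pi := abs_le.1 hω
  have hm' : ω + h ∈ Set.Icc (-Real.pi) Real.pi := abs_le.1 hω'
  have h1 := hφ.holder (ω + h) hm' ω hm h0' h0
  have h4 := hφ.nonneg _ hm'
  have h5 := hφ.le_mul _ hm'
  have h6 : 0 ≤ μ * φ 0 := h4.trans h5
  have h3 : |(|ω + h| - |ω|)| ^ ν ≤ h ^ ν := by
    refine Real.rpow_le_rpow (abs_nonneg _) ?_ hν.le
    have := abs_abs_sub_abs_le (ω + h) ω
    rwa [add_sub_cancel_left, abs_of_nonneg hh] at this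
  have g2 : 0 ≤ |ω| ^ (-2 * d) := by positivity
  unfold memoryDensity
  generalize |ω| ^ (-2 * d) = g at *
  generalize |ω + h| ^ (-2 * d) = g' at *
  have e : g' * φ (ω + h) - g * φ ω = (g' - g) * φ (ω + h) + g * (φ (ω + h) - φ ω) := by ring
  rw [e]
  calc _ ≤ |g' - g| * φ (ω + h) + g * |φ (ω + h) - φ ω| := by
        refine (abs_add_le _ _).trans ?_
        rw [abs_mul, abs_mul, abs_of_nonneg h4, abs_of_nonneg g2]
    _ ≤ |g' - g| * (μ * φ 0) + g * (μ * φ 0 * h ^ ν) := by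
        have := h1.trans (mul_le_mul_of_nonneg_left h3 h6)
        gcongr
    _ = _ := by ring

/-- If |ω - β| ≥ β/2, then |ω - β|/(β + |ω|) ≥ 1/5 and size bounds suffice. Otherwise ω is positive
and comparable to β, and the local Lipschitz bound applies. -/
theorem abs_memoryDensity_sub_center_le (hφ : LocalLipschitz μ ν φ)
    (hd : |-2 * d| ≤ 1) {ω β : ℝ} (hω : |ω| ≤ Real.pi) (hβ : 0 < β) (hβ' : β ≤ Real.pi) :
    |memoryDensity d φ ω - memoryDensity d φ β| ≤
      10 * (μ * φ 0) * (weight (-2 * d) β ω * |ω - β|) := by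
  have hβa : |β| = β := abs_of_pos hβ
  obtain ⟨f0, f1⟩ := memoryDensity_mem_Icc (d := d) ω hφ hω
  obtain ⟨f2, f3⟩ := memoryDensity_mem_Icc (d := d) β hφ (hβa.le.trans hβ')
  have hB : 0 ≤ μ * φ 0 := by
    have hm : ω ∈ Set.Icc (-Real.pi) Real.pi := abs_le.1 hω
    exact (hφ.nonneg ω hm).trans (hφ.le_mul ω hm)
  rw [hβa] at f3
  have g1 : 0 ≤ |ω| ^ (-2 * d) := by positivity
  have g2 : 0 ≤ β ^ (-2 * d) := by positivity
  have hsum : |ω| ≤ |ω - β| + β := by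
    have := abs_sub_abs_le_abs_sub ω β
    rw [hβa] at this; linarith
  rcases le_or_gt (β / 2) |ω - β| with h | h
  · calc _ ≤ (μ * φ 0) * (|ω| ^ (-2 * d) + β ^ (-2 * d)) := by
          rw [abs_le]; constructor <;> nlinarith
      _ = 5 * (μ * φ 0) * ((|ω| ^ (-2 * d) + β ^ (-2 * d)) * (1 / 5)) := by ring
      _ ≤ 10 * (μ * φ 0) * ((|ω| ^ (-2 * d) + β ^ (-2 * d)) * (|ω - β| / (β + |ω|))) := by
          have : 1 / 5 ≤ |ω - β| / (β + |ω|) := by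
            rw [div_le_div_iff₀ (by norm_num) (by positivity)]
            linarith
          gcongr
          norm_num
      _ = _ := by unfold weight; ring
  · have h' := abs_lt.1 h
    have hω0 : 0 < ω := by linarith
    have := abs_memoryDensity_sub_le hφ hd hω (hβa.le.trans hβ') hω0.ne' hβ.ne'
    rw [hβa] at this
    refine this.trans ?_
    have hmin : (β + |ω|) / 5 ≤ min |ω| β := by
      rw [abs_of_pos hω0]
      refine le_min ?_ ?_ <;> linarith
    have : |ω - β| / min |ω| β ≤ |ω - β| / ((β + |ω|) / 5) :=
      div_le_div_of_nonneg_left (abs_nonneg _) (by positivity) hmin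
    calc _ ≤ 2 * (μ * φ 0) * ((|ω| ^ (-2 * d) + β ^ (-2 * d)) * (|ω - β| / ((β + |ω|) / 5))) := by
          gcongr
      _ = _ := by unfold weight; field_simp; ring

end density

/-! ### Centring, and the bound without oscillation. -/

/-- Partial fractions: 1/(uv) = (1/u + 1/v)/(u + v), and separation of the centres forces u + v ≥ (β
+ |ω|)/5. -/
theorem kern_mul_kern_le {ε a b β : ℝ} (hε : 0 < ε) (hβ : 0 < β) (ha : |a| ≤ β) (hb : |b| ≤ β)
    (hab : β / 2 ≤ |a - b|) (ω : ℝ) :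
    kern ε a ω * kern ε b ω ≤ 5 * (1 / (β + |ω|) * (kern ε a ω + kern ε b ω)) := by
  unfold kern
  have h1 : |a - b| ≤ |ω - a| + |ω - b| := by
    rw [abs_sub_comm ω a]; exact abs_sub_le a ω b
  have h2 : |ω| ≤ |ω - a| + β := by linarith [abs_sub_abs_le_abs_sub ω a]
  have h3 : |ω| ≤ |ω - b| + β := by linarith [abs_sub_abs_le_abs_sub ω b]
  have hu : 0 < ε + |ω - a| := by positivity
  have hv : 0 < ε + |ω - b| := by positivity
  have hw : β + |ω| ≤ 5 * ((ε + |ω - a|) + (ε + |ω - b|)) := by linarith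
  have hw0 : 0 < β + |ω| := by positivity
  generalize ε + |ω - a| = u at *
  generalize ε + |ω - b| = v at *
  generalize β + |ω| = w at *
  have e : 5 * (1 / w * (1 / u + 1 / v)) = (5 * (u + v)) / w * (1 / u * (1 / v)) := by
    field_simp
    ring
  rw [e]
  refine le_mul_of_one_le_left (by positivity) ?_
  rw [le_div_iff₀ hw0]; linarith

/-- The integrable function dominating `|f - c| |D(a - ω) D(ω - b)|`. -/
def majorant (p ε β a b ω : ℝ) : ℝ := weight p β ω * (kern ε a ω + kern ε b ω)

theorem majorant_nonneg {p ε β : ℝ} (hε : 0 < ε) (hβ : 0 < β) (a b ω : ℝ) :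
    0 ≤ majorant p ε β a b ω :=
  mul_nonneg (weight_nonneg hβ ω) (add_nonneg (kern_pos hε a ω).le (kern_pos hε b ω).le)

theorem intervalIntegrable_majorant {p ε β : ℝ} (hp : -1 < p) (hε : 0 < ε) (hβ : 0 < β)
    (a b c d : ℝ) : IntervalIntegrable (majorant p ε β a b) volume c d := by
  have := (intervalIntegrable_weight_mul_kern hp hε hβ (a := a) c d).add
    (intervalIntegrable_weight_mul_kern hp hε hβ (a := b) c d)
  refine this.congr fun x _ => ?_
  simp only [majorant]; ring

/-- The size of the moment integrals. -/
def momentSize (p ε α β : ℝ) : ℝ := (α ^ p + β ^ p) * (1 + Real.log (1 + β / ε)) / β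

theorem integral_majorant_le {p κ ε a b β : ℝ} (hκ : 0 < κ) (hp : |p| ≤ 1 - κ) (hε : 0 < ε)
    (ha : 0 < a) (haβ : a ≤ β) (hb : |b| = β) (hβ : 2 * β ≤ Real.pi) :
    ∫ ω in (-Real.pi)..Real.pi, majorant p ε β a b ω ≤ 144 / κ * momentSize p ε a β := by
  have hp' := abs_le.1 hp
  have hβ0 : 0 < β := by linarith
  have haa : |a| = a := abs_of_pos ha
  have h1 := integral_weight_mul_kern_le hκ hp hε ha.ne' (haa.le.trans haβ) hβ
  have h2 := integral_weight_mul_kern_le hκ hp hε (abs_pos.1 (by rw [hb]; exact hβ0)) hb.le hβ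
  rw [haa] at h1
  rw [hb] at h2
  have hΛ : 0 ≤ Real.log (1 + β / ε) := Real.log_nonneg (by
    have : 0 < β / ε := by positivity
    linarith)
  simp only [majorant, mul_add]
  rw [intervalIntegral.integral_add (intervalIntegrable_weight_mul_kern (by linarith) hε hβ0 _ _)
    (intervalIntegrable_weight_mul_kern (by linarith) hε hβ0 _ _)]
  refine (add_le_add h1 h2).trans ?_
  have : 0 ≤ 96 / κ * (a ^ p * (1 + Real.log (1 + β / ε)) / β) := by positivity
  have e : 144 / κ * momentSize p ε a β =
    48 / κ * ((a ^ p + β ^ p) * (1 + Real.log (1 + β / ε)) / β) +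
    48 / κ * ((β ^ p + β ^ p) * (1 + Real.log (1 + β / ε)) / β) +
    96 / κ * (a ^ p * (1 + Real.log (1 + β / ε)) / β) := by
    unfold momentSize; ring
  linarith

/-- `c` may be subtracted from `f` in the moment integral with kernels centred at `a` and `b`:
either `c = 0` and the centres are separated, or they are comparable and `c = f b`. -/
def IsCentering (f : ℝ → ℝ) (a b β c : ℝ) : Prop :=
  (c = 0 ∧ β / 2 ≤ |a - b|) ∨ (c = f β ∧ b = β ∧ β ≤ 2 * a)

/-- One of the two kernels is removed: by partial fractions when the centres are separated, and by
|ω - b| · `kern ε b ω` ≤ 1 when c = f(β). -/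
theorem abs_sub_mul_kern_le {μ ν d : ℝ} {φ : ℝ → ℝ} (hφ : LocalLipschitz μ ν φ)
    (hd : |-2 * d| ≤ 1) {ε a b β c ω : ℝ} (hε : 0 < ε) (ha : 0 < a) (haβ : a ≤ β) (hb : |b| = β)
    (hβ : β ≤ Real.pi) (hc : IsCentering (memoryDensity d φ) a b β c) (hω : |ω| ≤ Real.pi) :
    |memoryDensity d φ ω - c| * (kern ε a ω * kern ε b ω) ≤
      10 * (μ * φ 0) * majorant (-2 * d) ε β a b ω := by
  have hβ0 : 0 < β := by linarith
  have hB : 0 ≤ μ * φ 0 := by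
    have hm : ω ∈ Set.Icc (-Real.pi) Real.pi := abs_le.1 hω
    exact (hφ.nonneg ω hm).trans (hφ.le_mul ω hm)
  have ka := kern_pos hε a ω
  have kb := kern_pos hε b ω
  have hw := weight_nonneg (p := -2 * d) hβ0 ω
  have g1 : 0 ≤ |ω| ^ (-2 * d) := by positivity
  have g2 : 0 ≤ β ^ (-2 * d) := by positivity
  rcases hc with ⟨rfl, hab⟩ | ⟨rfl, rfl, h2⟩
  · obtain ⟨f0, f1⟩ := memoryDensity_mem_Icc (d := d) ω hφ hω
    have k := kern_mul_kern_le hε hβ0 ((abs_of_pos ha).le.trans haβ) hb.le hab ω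
    rw [sub_zero, abs_of_nonneg f0]
    calc _ ≤ (μ * φ 0 * |ω| ^ (-2 * d)) * (5 * (1 / (β + |ω|) * (kern ε a ω + kern ε b ω))) :=
          mul_le_mul f1 k (by positivity) (by positivity)
      _ = 5 * (μ * φ 0) * (|ω| ^ (-2 * d) / (β + |ω|) * (kern ε a ω + kern ε b ω)) := by ring
      _ ≤ 10 * (μ * φ 0) * ((|ω| ^ (-2 * d) + β ^ (-2 * d)) / (β + |ω|) *
            (kern ε a ω + kern ε b ω)) := by
          gcongr
          · norm_num
          · linarith
      _ = _ := rfl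
  · have h1 := abs_memoryDensity_sub_center_le hφ hd hω hβ0 hβ
    have h3 : |ω - b| * kern ε b ω ≤ 1 := by
      unfold kern
      rw [mul_one_div, div_le_one (by positivity)]
      linarith
    calc _ ≤ (10 * (μ * φ 0) * (weight (-2 * d) b ω * |ω - b|)) * (kern ε a ω * kern ε b ω) := by
          gcongr
      _ = 10 * (μ * φ 0) * (weight (-2 * d) b ω * kern ε a ω * (|ω - b| * kern ε b ω)) := by ring
      _ ≤ 10 * (μ * φ 0) * (weight (-2 * d) b ω * kern ε a ω * 1) := by gcongr
      _ ≤ _ := by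
          unfold majorant
          rw [mul_one]
          gcongr
          linarith

/-- The character enters only through its modulus, so N is arbitrary. The constant is 174240 =
121·10·144. -/
theorem norm_integral_centered_le {μ ν d κ : ℝ} {φ : ℝ → ℝ} (hφ : LocalLipschitz μ ν φ)
    (hκ : 0 < κ) (hd : |-2 * d| ≤ 1 - κ) {n : ℕ} (hn : 1 ≤ n) {a b β c : ℝ} (ha : 0 < a)
    (haβ : a ≤ β) (hb : |b| = β) (hβ : 2 * β ≤ Real.pi)
    (hc : IsCentering (memoryDensity d φ) a b β c) (N : ℕ) :
    ‖∫ ω in (-Real.pi)..Real.pi, ((memoryDensity d φ ω - c : ℝ) : ℂ) *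
        (char N ω * crossKernel n a b ω)‖ ≤
      174240 / κ * (μ * φ 0) * momentSize (-2 * d) (1 / n) a β := by
  have hpi := Real.pi_pos
  have hε : (0 : ℝ) < 1 / n := by
    have : (0 : ℝ) < n := by exact_mod_cast hn
    positivity
  have hβ0 : 0 < β := by linarith
  have hp' := abs_le.1 hd
  have hB : 0 ≤ μ * φ 0 := by
    have hm : (0 : ℝ) ∈ Set.Icc (-Real.pi) Real.pi := ⟨by linarith, hpi.le⟩
    exact (hφ.nonneg 0 hm).trans (hφ.le_mul 0 hm)
  have hi := intervalIntegrable_majorant (p := -2 * d) (a := a) (b := b) (by linarith) hε hβ0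
    (-Real.pi) Real.pi
  calc _ ≤ ∫ ω in (-Real.pi)..Real.pi, 1210 * (μ * φ 0) * majorant (-2 * d) (1 / n) β a b ω := by
        refine intervalIntegral.norm_integral_le_of_norm_le (by linarith)
          (Filter.Eventually.of_forall fun ω hω => ?_) (hi.const_mul _)
        have hω' : |ω| ≤ Real.pi := abs_le.2 ⟨hω.1.le, hω.2⟩
        have h1 := abs_sub_mul_kern_le hφ (by linarith) hε ha haβ hb (by linarith) hc hω'
        have h2 := norm_crossKernel_le (a := a) (b := b) hn
          (by rw [abs_of_pos ha]; linarith) (by rw [hb]; linarith) hω'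
        rw [norm_mul, norm_mul, norm_char, one_mul, Complex.norm_real, Real.norm_eq_abs]
        calc _ ≤ |memoryDensity d φ ω - c| * (121 * (kern (1 / n) a ω * kern (1 / n) b ω)) := by
              gcongr
          _ = 121 * (|memoryDensity d φ ω - c| * (kern (1 / n) a ω * kern (1 / n) b ω)) := by ring
          _ ≤ 121 * (10 * (μ * φ 0) * majorant (-2 * d) (1 / n) β a b ω) := by gcongr
          _ = _ := by ring
    _ = 1210 * (μ * φ 0) * ∫ ω in (-Real.pi)..Real.pi, majorant (-2 * d) (1 / n) β a b ω :=
        intervalIntegral.integral_const_mul _ _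
    _ ≤ 1210 * (μ * φ 0) * (144 / κ * momentSize (-2 * d) (1 / n) a β) := by
        have := integral_majorant_le hκ hd hε ha haβ hb hβ
        gcongr
    _ = _ := by ring

/-! ### Half-period shift and periodic extension. -/

/-- A shift by π/N changes the sign of e^{iNω} and, by periodicity, preserves the integral. Hence
twice the integral is, up to sign, the integral of e^{iNω} against the increment of G. -/
theorem norm_integral_char_mul_le {G : ℝ → ℂ} {g : ℝ → ℝ} {N : ℕ} (hN : N ≠ 0)
    (hG : Function.Periodic G (2 * Real.pi))
    (hi : IntervalIntegrable G volume (-Real.pi) Real.pi)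
    (hg : IntervalIntegrable g volume (-Real.pi) Real.pi)
    (h : ∀ᵐ ω : ℝ, ω ∈ Set.Ioc (-Real.pi) Real.pi → ‖G (ω + Real.pi / N) - G ω‖ ≤ g ω) :
    ‖∫ ω in (-Real.pi)..Real.pi, char N ω * G ω‖ ≤ ∫ ω in (-Real.pi)..Real.pi, g ω := by
  have hpi := Real.pi_pos
  have hN' : (N : ℝ) ≠ 0 := by exact_mod_cast hN
  set δ := Real.pi / N
  have hchar : Function.Periodic (char N) (2 * Real.pi) := by
    intro ω
    unfold char
    rw [Complex.exp_eq_exp_iff_exists_int]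
    exact ⟨N, by push_cast; ring⟩
  have hshift : ∀ ω, char N (ω + δ) = -char N ω := by
    intro ω
    unfold char
    have : (N : ℝ) * (ω + δ) = N * ω + Real.pi := by
      simp only [δ]; field_simp
    rw [this, Complex.ofReal_add, mul_add, Complex.exp_add, mul_comm Complex.I (Real.pi : ℂ),
      Complex.exp_pi_mul_I]
    ring
  have hi' : IntervalIntegrable G volume (-Real.pi + δ) (Real.pi + δ) :=
    hG.intervalIntegrable (t := -Real.pi) (by positivity)
      (by rwa [show -Real.pi + 2 * Real.pi = Real.pi by ring]) _ _
  have hi'' : IntervalIntegrable (fun ω => G (ω + δ)) volume (-Real.pi) Real.pi := by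
    have := hi'.comp_add_right δ
    simpa using this
  have e1 : ∫ ω in (-Real.pi)..Real.pi, char N ω * G (ω + δ) =
      -∫ ω in (-Real.pi)..Real.pi, char N ω * G ω := by
    have hper : Function.Periodic (fun ω => char N ω * G ω) (2 * Real.pi) := hchar.mul hG
    have h1 := hper.intervalIntegral_add_eq (-Real.pi) (-Real.pi + δ)
    rw [show -Real.pi + 2 * Real.pi = Real.pi by ring,
      show -Real.pi + δ + 2 * Real.pi = Real.pi + δ by ring] at h1
    rw [h1, ← intervalIntegral.integral_comp_add_right (fun ω => char N ω * G ω) δ,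
      ← intervalIntegral.integral_neg]
    refine intervalIntegral.integral_congr fun ω _ => ?_
    simp only [hshift]; ring
  have e2 : 2 * ∫ ω in (-Real.pi)..Real.pi, char N ω * G ω =
      -∫ ω in (-Real.pi)..Real.pi, char N ω * (G (ω + δ) - G ω) := by
    have hc : ContinuousOn (char N) (Set.uIcc (-Real.pi) Real.pi) :=
      (continuous_char N).continuousOn
    simp only [mul_sub]
    rw [intervalIntegral.integral_sub (hi''.continuousOn_mul hc) (hi.continuousOn_mul hc), e1]
    ring
  have e3 : ‖∫ ω in (-Real.pi)..Real.pi, char N ω * (G (ω + δ) - G ω)‖ ≤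
      ∫ ω in (-Real.pi)..Real.pi, g ω := by
    refine intervalIntegral.norm_integral_le_of_norm_le (by linarith) ?_ hg
    filter_upwards [h] with ω hω hm
    rw [norm_mul, norm_char, one_mul]
    exact hω hm
  have e4 := congrArg norm e2
  rw [norm_mul, norm_neg] at e4
  simp only [Complex.norm_ofNat] at e4
  linarith [norm_nonneg (∫ ω in (-Real.pi)..Real.pi, char N ω * G ω)]

theorem dirichlet_periodic (n : ℕ) : Function.Periodic (dirichlet n) (2 * Real.pi) := by
  intro x
  unfold dirichlet
  refine Finset.sum_congr rfl fun t _ => ?_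
  rw [Complex.exp_eq_exp_iff_exists_int]
  exact ⟨t, by push_cast; ring⟩

theorem crossKernel_periodic (n : ℕ) (a b : ℝ) :
    Function.Periodic (crossKernel n a b) (2 * Real.pi) := by
  intro ω
  unfold crossKernel
  rw [show a - (ω + 2 * Real.pi) = a - ω - 2 * Real.pi by ring, (dirichlet_periodic n).sub_eq,
    show ω + 2 * Real.pi - b = ω - b + 2 * Real.pi by ring, dirichlet_periodic n]

/-- The distance from `ω` to `2πℤ`. -/
def circleDist (ω : ℝ) : ℝ := ‖(ω : AddCircle (2 * Real.pi))‖

theorem circleDist_periodic : Function.Periodic circleDist (2 * Real.pi) := by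
  intro ω
  unfold circleDist
  rw [AddCircle.coe_add_period]

theorem circleDist_of_abs_le {ω : ℝ} (h : |ω| ≤ Real.pi) : circleDist ω = |ω| := by
  refine (AddCircle.norm_coe_eq_abs_iff _ (by positivity)).2 ?_
  rw [abs_of_pos Real.two_pi_pos]
  linarith

theorem circleDist_nonneg (ω : ℝ) : 0 ≤ circleDist ω := norm_nonneg _

theorem circleDist_le (ω : ℝ) : circleDist ω ≤ Real.pi := by
  have := AddCircle.norm_le_half_period (2 * Real.pi) (x := (ω : AddCircle (2 * Real.pi)))
    (by positivity)
  rw [abs_of_pos Real.two_pi_pos] at this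
  unfold circleDist
  linarith

theorem circleDist_le_abs (ω : ℝ) : circleDist ω ≤ |ω| := by
  rcases le_total |ω| Real.pi with h | h
  · exact (circleDist_of_abs_le h).le
  · exact (circleDist_le ω).trans h

/-- Lipschitz across ±π as well, so composing the even density with `circleDist` extends it
periodically without losing regularity there. -/
theorem abs_circleDist_sub_le (ω h : ℝ) : |circleDist (ω + h) - circleDist ω| ≤ |h| := by
  refine le_trans ?_ (circleDist_le_abs h)
  unfold circleDist
  have := abs_norm_sub_norm_le ((ω + h : ℝ) : AddCircle (2 * Real.pi))
    (ω : AddCircle (2 * Real.pi))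
  refine this.trans (le_of_eq ?_)
  rw [← AddCircle.coe_sub, add_sub_cancel_left]

section shift

variable {μ ν d : ℝ} {φ : ℝ → ℝ}

theorem abs_memoryDensity_circleDist_shift_le (hφ : LocalLipschitz μ ν φ)
    (hd : |-2 * d| ≤ 1) {ω h : ℝ} (hω : |ω| ≤ Real.pi) (hh : 0 < h) (hωh : 2 * h ≤ |ω|) :
    |memoryDensity d φ (circleDist (ω + h)) - memoryDensity d φ (abs ω)| ≤
      20 * (μ * φ 0) * (|ω| ^ (-2 * d) * (h / |ω|)) := by
  have h1 := abs_circleDist_sub_le ω h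
  rw [circleDist_of_abs_le hω, abs_of_pos hh] at h1
  have h1' := abs_le.1 h1
  have h2 := circleDist_nonneg (ω + h)
  have h3 := circleDist_le (ω + h)
  have hω0 : 0 < |ω| := by linarith
  generalize circleDist (ω + h) = r at *
  have hr : 0 < r := by linarith
  have hB : 0 ≤ μ * φ 0 := by
    have hm : ω ∈ Set.Icc (-Real.pi) Real.pi := abs_le.1 hω
    exact (hφ.nonneg ω hm).trans (hφ.le_mul ω hm)
  have h4 := abs_memoryDensity_sub_le hφ hd (ω := r) (ω' := |ω|)
    (by rwa [abs_of_nonneg h2]) (by rwa [abs_abs]) hr.ne' hω0.ne'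
  rw [abs_abs, abs_of_pos hr] at h4
  have h5 := rpow_le_two_mul_add hd hω0 hω0 (x := r) (by linarith) (by linarith)
  have g1 : 0 ≤ |ω| ^ (-2 * d) := by positivity
  have h6 : |r - abs ω| / min r |ω| ≤ h / (|ω| / 2) :=
    div_le_div₀ hh.le h1 (by positivity) (le_min (by linarith) (by linarith))
  refine h4.trans ?_
  have : 0 < min r |ω| := lt_min hr hω0
  calc _ ≤ 2 * (μ * φ 0) * ((2 * (|ω| ^ (-2 * d) + |ω| ^ (-2 * d)) + |ω| ^ (-2 * d)) *
        (h / (|ω| / 2))) := by gcongr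
    _ = _ := by field_simp; ring

/-- Increments of f do not see c, yet two kernels must again become one. Separated centres: partial
fractions, with h/|ω| ≤ 1/ℓ. Comparable centres: 1/|ω| ≤ 5/(b + |ω|), while h absorbs the kernel at
b, which is at most 1/ε. -/
theorem shift_mul_kern_far_le (hφ : LocalLipschitz μ ν φ)
    (hd : |-2 * d| ≤ 1) {ε a b β c ω h : ℝ} {ℓ : ℕ} (hε : 0 < ε) (haε : 2 * Real.pi * ε ≤ a)
    (haβ : a ≤ β) (hb : |b| = β) (hc : IsCentering (memoryDensity d φ) a b β c)
    (hω : |ω| ≤ Real.pi) (hℓ : 2 ≤ ℓ) (hh : h = Real.pi * ε / ℓ) (haω : a / 2 ≤ |ω|) :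
    |memoryDensity d φ (circleDist (ω + h)) - memoryDensity d φ (abs ω)| *
      (kern ε a ω * kern ε b ω) ≤ 400 * (μ * φ 0) / ℓ * majorant (-2 * d) ε β a b ω := by
  have hpi := Real.pi_pos
  have hℓ' : (2 : ℝ) ≤ ℓ := by exact_mod_cast hℓ
  have ha : 0 < a := lt_of_lt_of_le (by positivity) haε
  have hβ0 : 0 < β := by linarith
  have hh0 : 0 < h := by rw [hh]; positivity
  have hB : 0 ≤ μ * φ 0 := by
    have hm : ω ∈ Set.Icc (-Real.pi) Real.pi := abs_le.1 hω
    exact (hφ.nonneg ω hm).trans (hφ.le_mul ω hm)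
  have ka := kern_pos hε a ω
  have kb := kern_pos hε b ω
  have hω0 : 0 < |ω| := by linarith
  have g1 : 0 ≤ |ω| ^ (-2 * d) := by positivity
  have g2 : 0 ≤ β ^ (-2 * d) := by positivity
  have hhℓ : h * ℓ = Real.pi * ε := by rw [hh]; field_simp
  -- This uses ℓ ≥ 2: 2h ≤ πε ≤ a/2 ≤ |ω|.
  have h1 := abs_memoryDensity_circleDist_shift_le hφ hd hω hh0 (by nlinarith)
  refine (mul_le_mul_of_nonneg_right h1 (by positivity)).trans ?_
  have hw := weight_nonneg (p := -2 * d) hβ0 ω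
  have hgw : |ω| ^ (-2 * d) / (β + |ω|) ≤ weight (-2 * d) β ω := by
    unfold weight; gcongr; linarith
  suffices hs : |ω| ^ (-2 * d) * (h / |ω|) * (kern ε a ω * kern ε b ω) ≤
      20 / ℓ * majorant (-2 * d) ε β a b ω by
    calc _ = 20 * (μ * φ 0) * (|ω| ^ (-2 * d) * (h / |ω|) * (kern ε a ω * kern ε b ω)) := by ring
      _ ≤ 20 * (μ * φ 0) * (20 / ℓ * majorant (-2 * d) ε β a b ω) := by gcongr
      _ = _ := by ring
  rcases hc with ⟨-, hab⟩ | ⟨-, rfl, h2⟩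
  · have k := kern_mul_kern_le hε hβ0 ((abs_of_pos ha).le.trans haβ) hb.le hab ω
    have h3 : h / |ω| ≤ 1 / ℓ := by
      rw [div_le_div_iff₀ hω0 (by positivity)]; linarith
    calc _ ≤ |ω| ^ (-2 * d) * (1 / ℓ) * (5 * (1 / (β + |ω|) * (kern ε a ω + kern ε b ω))) := by
          gcongr
      _ = 5 / ℓ * (|ω| ^ (-2 * d) / (β + |ω|) * (kern ε a ω + kern ε b ω)) := by ring
      _ ≤ 20 / ℓ * (weight (-2 * d) β ω * (kern ε a ω + kern ε b ω)) := by
          gcongr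
          norm_num
      _ = _ := rfl
  · have h3 : h * kern ε b ω ≤ 4 / ℓ := by
      have : kern ε b ω ≤ 1 / ε :=
        one_div_le_one_div_of_le hε (le_add_of_nonneg_right (abs_nonneg _))
      calc _ ≤ h * (1 / ε) := by gcongr
        _ = Real.pi / ℓ := by rw [hh]; field_simp
        _ ≤ 4 / ℓ := by gcongr; exact Real.pi_le_four
    have h4 : 1 / |ω| ≤ 5 / (b + |ω|) := by
      rw [div_le_div_iff₀ hω0 (by positivity)]; linarith
    calc _ = |ω| ^ (-2 * d) * (1 / |ω|) * (kern ε a ω * (h * kern ε b ω)) := by ring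
      _ ≤ |ω| ^ (-2 * d) * (5 / (b + |ω|)) * (kern ε a ω * (4 / ℓ)) := by gcongr
      _ = 20 / ℓ * (|ω| ^ (-2 * d) / (b + |ω|) * kern ε a ω) := by ring
      _ ≤ 20 / ℓ * (weight (-2 * d) b ω * (kern ε a ω + kern ε b ω)) := by
          gcongr
          linarith
      _ = _ := rfl

/-- For |ω| ≤ a/2 both centres are far, so the kernels are at most 2/a and 2/β, and ω + h stays in
[-π, π]. -/
theorem shift_mul_kern_near_le (hφ : LocalLipschitz μ ν φ) (hν : 0 < ν)
    {ε a b β ω h : ℝ} (hε : 0 < ε) (ha : 0 < a)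
    (haβ : a ≤ β) (hβ : 2 * β ≤ Real.pi) (hb : |b| = β) (hh : 0 < h) (hha : 2 * h ≤ a)
    (haω : |ω| ≤ a / 2) (h0 : ω ≠ 0) (h0' : ω + h ≠ 0) :
    |memoryDensity d φ (circleDist (ω + h)) - memoryDensity d φ (abs ω)| *
      (kern ε a ω * kern ε b ω) ≤ 4 * (μ * φ 0) * (1 / (a * β) *
        (|(|ω + h| ^ (-2 * d) - |ω| ^ (-2 * d))| + |ω| ^ (-2 * d) * h ^ ν)) := by
  have hβ0 : 0 < β := by linarith
  have hω : |ω| ≤ Real.pi := by linarith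
  have hωh : |ω + h| ≤ Real.pi := by
    have := abs_add_le ω h
    rw [abs_of_pos hh] at this
    linarith
  have ka := kern_pos hε a ω
  have kb := kern_pos hε b ω
  have h1 := abs_memoryDensity_sub_le_holder (d := d) hφ hν hω hωh h0 h0' hh.le
  rw [circleDist_of_abs_le hωh, memoryDensity_abs hφ hν hωh, memoryDensity_abs hφ hν hω]
  have h2 : kern ε a ω ≤ 2 / a := by
    unfold kern
    rw [div_le_div_iff₀ (by positivity) ha]
    have := abs_sub_abs_le_abs_sub a ω
    rw [abs_of_pos ha, abs_sub_comm] at this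
    linarith
  have h3 : kern ε b ω ≤ 2 / β := by
    unfold kern
    rw [div_le_div_iff₀ (by positivity) hβ0]
    have := abs_sub_abs_le_abs_sub b ω
    rw [hb, abs_sub_comm] at this
    linarith
  calc _ ≤ (μ * φ 0 * (|(|ω + h| ^ (-2 * d) - |ω| ^ (-2 * d))| + |ω| ^ (-2 * d) * h ^ ν)) *
        (2 / a * (2 / β)) := by
        refine mul_le_mul h1 (mul_le_mul h2 h3 kb.le (by positivity)) (by positivity) ?_
        exact (abs_nonneg _).trans h1
    _ = _ := by field_simp; ring

end shift

/-! ### Decay in the epoch distance ℓ. -/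

section oscillation

variable {μ ν d κ : ℝ} {φ : ℝ → ℝ}

/-- The function dominating the increments of the spectral density on `[-a/2, a/2]`. -/
def incrementMajorant (p ν a β h ω : ℝ) : ℝ :=
  1 / (a * β) * (|(|ω + h| ^ p - |ω| ^ p)| + |ω| ^ p * h ^ ν)

theorem intervalIntegrable_incrementMajorant {p : ℝ} (hp : -1 < p) (ν a β h c d : ℝ) :
    IntervalIntegrable (incrementMajorant p ν a β h) volume c d :=
  (((intervalIntegrable_shift hp h c d).sub (intervalIntegrable_abs_rpow hp c d)).abs.add
    ((intervalIntegrable_abs_rpow hp c d).mul_const _)).const_mul _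

theorem le_momentSize {p ε a β : ℝ} (hε : 0 < ε) (ha : 0 < a) (hβ : 0 < β) :
    a ^ p / β ≤ momentSize p ε a β := by
  have hΛ : 0 ≤ Real.log (1 + β / ε) := Real.log_nonneg (by
    have : 0 < β / ε := by positivity
    linarith)
  have h1 : 0 < a ^ p := by positivity
  have h2 : 0 < β ^ p := by positivity
  unfold momentSize
  gcongr
  nlinarith

/-- Since a ≥ 2π/n, the shift satisfies h ≤ a/(2ℓ). Thus h^{1+p} yields ℓ^{-(1+p)} and h a^p yields
ℓ^{-1}, whence the minimum in the exponent. -/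
theorem integral_incrementMajorant_le {p a β h : ℝ} {n ℓ : ℕ} (hκ : 0 < κ) (hp : |p| ≤ 1 - κ)
    (hν1 : ν ≤ 1) (hn : 1 ≤ n) (hℓ : 1 ≤ ℓ) (ha : 2 * Real.pi * (1 / n) ≤ a)
    (hβ : 0 < β) (hh : h = Real.pi * (1 / n) / ℓ) :
    ∫ ω in (-(a / 2))..(a / 2), incrementMajorant p ν a β h ω ≤
      1 / κ * momentSize p (1 / n) a β *
        (30 * (ℓ : ℝ) ^ (-(min (1 + p) 1)) + 8 * ((ℓ : ℝ) * n) ^ (-ν)) := by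
  have hp' := abs_le.1 hp
  have hp1 : -1 < p := by linarith
  have hpi := Real.pi_pos
  have hn' : (0 : ℝ) < n := by exact_mod_cast hn
  have hℓ1 : (1 : ℝ) ≤ ℓ := by exact_mod_cast hℓ
  have hℓ' : (0 : ℝ) < ℓ := by linarith
  have ha0 : 0 < a := lt_of_lt_of_le (by positivity) ha
  have hh0 : 0 < h := by rw [hh]; positivity
  have hha : h ≤ a / (2 * ℓ) := by
    rw [hh, div_le_div_iff₀ hℓ' (by positivity)]
    nlinarith
  have hha2 : h ≤ a / 2 := hha.trans (div_le_div_of_nonneg_left ha0.le (by norm_num) (by linarith))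
  have hap : 0 < a ^ p := by positivity
  have q1 := integral_abs_shift_sub_le hκ hp hh0 hha2
  have q2 : ∫ ω in (-(a / 2))..(a / 2), |ω| ^ p ≤ 2 * (a * a ^ p / κ) := by
    rw [integral_symm_eq (by linarith) (intervalIntegrable_abs_rpow hp1 _ _)]
    have e : ∫ x in (0 : ℝ)..(a / 2), (|x| ^ p + |-x| ^ p) =
        2 * ∫ x in (0 : ℝ)..(a / 2), x ^ p := by
      rw [← intervalIntegral.integral_const_mul]
      refine intervalIntegral.integral_congr fun x hx => ?_
      rw [Set.uIcc_of_le (by linarith)] at hx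
      simp only [abs_neg, abs_of_nonneg hx.1]; ring
    rw [e]
    have h1 := integral_rpow_zero_le hκ hp (by linarith : (0 : ℝ) ≤ a / 2)
    have h2 : (a / 2) ^ (p + 1) ≤ a * a ^ p := by
      calc (a / 2) ^ (p + 1) ≤ a ^ (p + 1) :=
            Real.rpow_le_rpow (by linarith) (by linarith) (by linarith)
        _ = _ := by rw [Real.rpow_add ha0, Real.rpow_one]; ring
    have h3 : (a / 2) ^ (p + 1) / κ ≤ a * a ^ p / κ := by gcongr
    linarith
  set m := min (1 + p) 1
  have l1 : (ℓ : ℝ) ^ (-(1 + p)) ≤ (ℓ : ℝ) ^ (-m) :=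
    Real.rpow_le_rpow_of_exponent_le hℓ1 (neg_le_neg (min_le_left _ _))
  have l2 : 1 / (ℓ : ℝ) ≤ (ℓ : ℝ) ^ (-m) := by
    have : (ℓ : ℝ) ^ (-1 : ℝ) ≤ (ℓ : ℝ) ^ (-m) :=
      Real.rpow_le_rpow_of_exponent_le hℓ1 (neg_le_neg (min_le_right _ _))
    rwa [Real.rpow_neg_one, ← one_div] at this
  have r1 : h * h ^ p ≤ a * a ^ p * (ℓ : ℝ) ^ (-m) := by
    calc h * h ^ p = h ^ (1 + p) := by rw [Real.rpow_add hh0, Real.rpow_one]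
      _ ≤ (a / ℓ) ^ (1 + p) := by
          refine Real.rpow_le_rpow hh0.le (hha.trans ?_) (by linarith)
          exact div_le_div_of_nonneg_left ha0.le hℓ' (by linarith)
      _ = a * a ^ p * (ℓ : ℝ) ^ (-(1 + p)) := by
          rw [Real.div_rpow ha0.le hℓ'.le, Real.rpow_neg hℓ'.le, Real.rpow_add ha0, Real.rpow_one]
          rfl
      _ ≤ _ := by gcongr
  have r2 : h * (a / 2) ^ p ≤ 2 * (a * a ^ p * (ℓ : ℝ) ^ (-m)) := by
    have h1 := rpow_le_two_mul_add (p := p) (x := a / 2) (by linarith) ha0 ha0 le_rfl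
      (by linarith)
    calc _ ≤ a / (2 * ℓ) * (2 * (a ^ p + a ^ p)) := by gcongr
      _ = 2 * (a * a ^ p * (1 / ℓ)) := by field_simp; ring
      _ ≤ _ := by gcongr
  have r3 : h ^ ν ≤ 4 * ((ℓ : ℝ) * n) ^ (-ν) := by
    have : h = Real.pi * ((ℓ : ℝ) * n)⁻¹ := by rw [hh]; field_simp
    rw [this, Real.mul_rpow hpi.le (by positivity), Real.inv_rpow (by positivity),
      ← Real.rpow_neg (by positivity)]
    have : Real.pi ^ ν ≤ 4 := by
      calc Real.pi ^ ν ≤ Real.pi ^ (1 : ℝ) :=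
            Real.rpow_le_rpow_of_exponent_le (by linarith [Real.pi_gt_three]) hν1
        _ ≤ 4 := by rw [Real.rpow_one]; exact Real.pi_le_four
    gcongr
  have e1 : ∫ ω in (-(a / 2))..(a / 2), incrementMajorant p ν a β h ω =
      1 / (a * β) * ((∫ ω in (-(a / 2))..(a / 2), |(|ω + h| ^ p - |ω| ^ p)|) +
        (∫ ω in (-(a / 2))..(a / 2), |ω| ^ p) * h ^ ν) := by
    unfold incrementMajorant
    rw [intervalIntegral.integral_const_mul, intervalIntegral.integral_add
      ((intervalIntegrable_shift hp1 h _ _).sub (intervalIntegrable_abs_rpow hp1 _ _)).abs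
      ((intervalIntegrable_abs_rpow hp1 _ _).mul_const _), intervalIntegral.integral_mul_const]
  rw [e1]
  have hL : 0 ≤ (ℓ : ℝ) ^ (-m) := by positivity
  have hLn : 0 ≤ ((ℓ : ℝ) * n) ^ (-ν) := by positivity
  calc _ ≤ 1 / (a * β) * (10 / κ * (3 * (a * a ^ p * (ℓ : ℝ) ^ (-m))) +
        2 * (a * a ^ p / κ) * (4 * ((ℓ : ℝ) * n) ^ (-ν))) := by
        have : h * (h ^ p + (a / 2) ^ p) ≤ 3 * (a * a ^ p * (ℓ : ℝ) ^ (-m)) := by linarith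
        have : 10 / κ * (h * (h ^ p + (a / 2) ^ p)) ≤
          10 / κ * (3 * (a * a ^ p * (ℓ : ℝ) ^ (-m))) := by gcongr
        gcongr
        linarith
    _ = 1 / κ * (a ^ p / β) *
        (30 * (ℓ : ℝ) ^ (-m) + 8 * ((ℓ : ℝ) * n) ^ (-ν)) := by field_simp; ring
    _ ≤ _ := by
        have := le_momentSize (p := p) (ε := 1 / (n : ℝ)) (by positivity) ha0 hβ
        gcongr

theorem norm_integral_oscillating_le (hφ : LocalLipschitz μ ν φ) (hν : 0 < ν) (hν1 : ν ≤ 1)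
    (hκ : 0 < κ) (hd : |-2 * d| ≤ 1 - κ) {n ℓ : ℕ} (hn : 1 ≤ n) (hℓ : 2 ≤ ℓ) {a b β c : ℝ}
    (ha : 2 * Real.pi * (1 / n) ≤ a) (haβ : a ≤ β) (hb : |b| = β) (hβ : 2 * β ≤ Real.pi)
    (hc : IsCentering (memoryDensity d φ) a b β c)
    (hf : IntervalIntegrable (memoryDensity d φ) volume (-Real.pi) Real.pi) :
    ‖∫ ω in (-Real.pi)..Real.pi, ((memoryDensity d φ ω - c : ℝ) : ℂ) *
        (char (ℓ * n) ω * crossKernel n a b ω)‖ ≤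
      700000000 / κ * (μ * φ 0) * momentSize (-2 * d) (1 / n) a β *
        ((ℓ : ℝ) ^ (-(min (1 - 2 * d) 1)) + ((ℓ : ℝ) * n) ^ (-ν)) := by
  have hpi := Real.pi_pos
  have hn' : (0 : ℝ) < n := by exact_mod_cast hn
  have hε : (0 : ℝ) < 1 / n := by positivity
  have hℓ2 : (2 : ℝ) ≤ ℓ := by exact_mod_cast hℓ
  have hℓ' : (0 : ℝ) < ℓ := by linarith
  have ha0 : 0 < a := lt_of_lt_of_le (by positivity) ha
  have hβ0 : 0 < β := by linarith
  have hp' := abs_le.1 hd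
  have hp1 : -1 < -2 * d := by linarith
  have hd1 : |-2 * d| ≤ 1 := by linarith
  have hB : 0 ≤ μ * φ 0 := by
    have hm : (0 : ℝ) ∈ Set.Icc (-Real.pi) Real.pi := ⟨by linarith, hpi.le⟩
    exact (hφ.nonneg 0 hm).trans (hφ.le_mul 0 hm)
  set B := μ * φ 0 with hBdef
  set h := Real.pi * (1 / n) / ℓ with hh
  have hh0 : 0 < h := by positivity
  have hnh : n * |h| = Real.pi / ℓ := by rw [abs_of_pos hh0, hh]; field_simp
  have hπℓ : Real.pi / ℓ ≤ 4 / ℓ := by gcongr; exact Real.pi_le_four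
  have hnh4 : n * |h| ≤ 4 := by
    rw [hnh, div_le_iff₀ hℓ']; linarith [Real.pi_le_four]
  have h2a : 2 * h ≤ a := by
    have : h ≤ Real.pi * (1 / n) := by
      rw [hh]; exact div_le_self (by positivity) (by linarith)
    linarith
  -- Periodic extension of the density: `memoryDensity` itself is not controlled outside [-π, π],
  -- where ω + h may fall.
  set F : ℝ → ℝ := fun ω => memoryDensity d φ (circleDist ω) with hF
  have hFf : ∀ ω, |ω| ≤ Real.pi → F ω = memoryDensity d φ ω := by
    intro ω hω
    simp only [hF]
    rw [circleDist_of_abs_le hω, memoryDensity_abs hφ hν hω]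
  set G : ℝ → ℂ := fun ω => ((F ω - c : ℝ) : ℂ) * crossKernel n a b ω with hG
  have hGper : Function.Periodic G (2 * Real.pi) := by
    intro ω
    simp only [hG, hF, circleDist_periodic ω, crossKernel_periodic n a b ω]
  have hGi : IntervalIntegrable G volume (-Real.pi) Real.pi := by
    have h1 : IntervalIntegrable (fun ω => ((memoryDensity d φ ω - c : ℝ) : ℂ)) volume
        (-Real.pi) Real.pi := by
      have := hf.sub (intervalIntegrable_const (c := c))
      exact ⟨this.1.ofReal, this.2.ofReal⟩
    refine (h1.mul_continuousOn (continuous_crossKernel n a b).continuousOn).congr ?_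
    intro ω hω
    rw [Set.uIoc_of_le (by linarith)] at hω
    simp only [hG]
    rw [hFf ω (abs_le.2 ⟨hω.1.le, hω.2⟩)]
  set S : ℝ → ℝ := Set.indicator (Set.Ioc (-(a / 2)) (a / 2))
    (incrementMajorant (-2 * d) ν a β h) with hS
  have hsub : Set.Ioc (-(a / 2)) (a / 2) ⊆ Set.Ioc (-Real.pi) Real.pi :=
    Set.Ioc_subset_Ioc (by linarith) (by linarith)
  have hinc := fun u v => intervalIntegrable_incrementMajorant hp1 ν a β h u v
  have hSi : IntervalIntegrable S volume (-Real.pi) Real.pi := by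
    rw [intervalIntegrable_iff_integrableOn_Ioc_of_le (by linarith)]
    refine IntegrableOn.indicator ?_ measurableSet_Ioc
    rw [← intervalIntegrable_iff_integrableOn_Ioc_of_le (by linarith)]
    exact hinc _ _
  have hSint : ∫ ω in (-Real.pi)..Real.pi, S ω =
      ∫ ω in (-(a / 2))..(a / 2), incrementMajorant (-2 * d) ν a β h ω := by
    rw [intervalIntegral.integral_of_le (by linarith), intervalIntegral.integral_of_le (by linarith),
      hS, setIntegral_indicator measurableSet_Ioc, Set.inter_eq_right.2 hsub]
  have hS0 : ∀ ω, 0 ≤ S ω := by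
    intro ω
    refine Set.indicator_nonneg (fun x _ => ?_) ω
    unfold incrementMajorant
    positivity
  have hmi := intervalIntegrable_majorant (p := -2 * d) (a := a) (b := b) hp1 hε hβ0
    (-Real.pi) Real.pi
  have hdom : ∀ ω, |ω| ≤ Real.pi → ω ≠ 0 → ω + h ≠ 0 → ‖G (ω + h) - G ω‖ ≤
      4000000 * B * (majorant (-2 * d) (1 / n) β a b ω * (1 / ℓ) + S ω) := by
    intro ω hω h0 h0'
    obtain ⟨k1, k2⟩ := norm_crossKernel_shift_le (a := a) (b := b) (h := h) hn
      (by rw [abs_of_pos ha0]; linarith) (by rw [hb]; linarith) hω hnh4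
    have hm0 := majorant_nonneg (p := -2 * d) hε hβ0 a b ω
    have ka := kern_pos hε a ω
    have kb := kern_pos hε b ω
    have c1 := abs_sub_mul_kern_le hφ hd1 hε ha0 haβ hb (by linarith) hc hω
    -- Discrete product rule; the constant c survives only beside the increment of the kernels.
    have e : G (ω + h) - G ω = ((F (ω + h) - F ω : ℝ) : ℂ) * crossKernel n a b (ω + h) +
        ((F ω - c : ℝ) : ℂ) * (crossKernel n a b (ω + h) - crossKernel n a b ω) := by
      simp only [hG]; push_cast; ring
    have c2 : |F (ω + h) - F ω| * (kern (1 / n) a ω * kern (1 / n) b ω) ≤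
        400 * B * (majorant (-2 * d) (1 / n) β a b ω * (1 / ℓ)) + 4 * B * S ω := by
      have hFω : F ω = memoryDensity d φ |ω| := by
        simp only [hF]; rw [circleDist_of_abs_le hω]
      rw [hFω]
      rcases lt_or_ge |ω| (a / 2) with hlt | hge
      · have := shift_mul_kern_near_le (d := d) hφ hν hε ha0 haβ hβ hb hh0 h2a hlt.le h0 h0'
        have hmem : ω ∈ Set.Ioc (-(a / 2)) (a / 2) := ⟨(abs_lt.1 hlt).1, (abs_lt.1 hlt).2.le⟩
        have hSω : S ω = incrementMajorant (-2 * d) ν a β h ω := Set.indicator_of_mem hmem _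
        rw [hSω]
        refine this.trans (le_add_of_nonneg_left (by positivity))
      · have := shift_mul_kern_far_le hφ hd1 hε ha haβ hb hc hω hℓ hh hge
        have hSω := hS0 ω
        refine this.trans ?_
        have e' : 400 * B / ℓ * majorant (-2 * d) (1 / n) β a b ω =
          400 * B * (majorant (-2 * d) (1 / n) β a b ω * (1 / ℓ)) := by ring
        rw [hBdef] at e'
        rw [e']
        exact le_add_of_nonneg_right (by positivity)
    rw [e]
    refine (norm_add_le _ _).trans ?_
    rw [norm_mul, norm_mul, Complex.norm_real, Complex.norm_real, Real.norm_eq_abs,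
      Real.norm_eq_abs]
    have hSω := hS0 ω
    calc _ ≤ |F (ω + h) - F ω| * (9025 * (kern (1 / n) a ω * kern (1 / n) b ω)) +
          |F ω - c| * (2226 * (4 / ℓ) * (kern (1 / n) a ω * kern (1 / n) b ω)) := by
          rw [hnh] at k2
          have : 2226 * (Real.pi / ℓ) * (kern (1 / n) a ω * kern (1 / n) b ω) ≤
            2226 * (4 / ℓ) * (kern (1 / n) a ω * kern (1 / n) b ω) := by gcongr
          have := k2.trans this
          gcongr
      _ = 9025 * (|F (ω + h) - F ω| * (kern (1 / n) a ω * kern (1 / n) b ω)) +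
          8904 * (1 / ℓ) * (|F ω - c| * (kern (1 / n) a ω * kern (1 / n) b ω)) := by ring
      _ ≤ 9025 * (400 * B * (majorant (-2 * d) (1 / n) β a b ω * (1 / ℓ)) + 4 * B * S ω) +
          8904 * (1 / ℓ) * (10 * B * majorant (-2 * d) (1 / n) β a b ω) := by
          rw [hFf ω hω] at c2 ⊢
          gcongr
      _ = 3699040 * B * (majorant (-2 * d) (1 / n) β a b ω * (1 / ℓ)) + 36100 * B * S ω := by
          ring
      _ ≤ 4000000 * B * (majorant (-2 * d) (1 / n) β a b ω * (1 / ℓ)) + 4000000 * B * S ω := by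
          gcongr <;> norm_num
      _ = _ := by ring
  have hδ : Real.pi / ((ℓ * n : ℕ) : ℝ) = h := by
    rw [hh]; push_cast; field_simp
  have hN : ℓ * n ≠ 0 := Nat.mul_ne_zero (by omega) (by omega)
  have hmain := norm_integral_char_mul_le (g := fun ω =>
    4000000 * B * (majorant (-2 * d) (1 / n) β a b ω * (1 / ℓ) + S ω)) hN hGper hGi
    (((hmi.mul_const _).add hSi).const_mul _) (by
      -- The regularity conditions exclude the origin, hence ω = 0 and ω = -h are discarded.
      have z1 : ∀ᵐ ω : ℝ, ω ≠ 0 := by simp [ae_iff]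
      have z2 : ∀ᵐ ω : ℝ, ω ≠ -h := by simp [ae_iff]
      filter_upwards [z1, z2] with ω h1 h2 hm
      rw [hδ]
      exact hdom ω (abs_le.2 ⟨hm.1.le, hm.2⟩) h1 (fun h' => h2 (by linarith)))
  have e1 : ∫ ω in (-Real.pi)..Real.pi, ((memoryDensity d φ ω - c : ℝ) : ℂ) *
        (char (ℓ * n) ω * crossKernel n a b ω) =
      ∫ ω in (-Real.pi)..Real.pi, char (ℓ * n) ω * G ω := by
    refine intervalIntegral.integral_congr fun ω hω => ?_
    rw [Set.uIcc_of_le (by linarith)] at hω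
    simp only [hG]
    rw [hFf ω (abs_le.2 hω)]
    ring
  rw [e1]
  refine hmain.trans ?_
  rw [intervalIntegral.integral_const_mul, intervalIntegral.integral_add (hmi.mul_const _) hSi,
    intervalIntegral.integral_mul_const, hSint]
  have b1 := integral_majorant_le hκ hd hε ha0 haβ hb hβ
  have b2 := integral_incrementMajorant_le (β := β) hκ hd hν1 hn (by omega) ha hβ0 hh
  have em : (1 : ℝ) + -2 * d = 1 - 2 * d := by ring
  rw [em] at b2
  have l2 : 1 / (ℓ : ℝ) ≤ (ℓ : ℝ) ^ (-(min (1 - 2 * d) 1)) := by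
    have : (ℓ : ℝ) ^ (-1 : ℝ) ≤ (ℓ : ℝ) ^ (-(min (1 - 2 * d) 1)) :=
      Real.rpow_le_rpow_of_exponent_le (by linarith) (neg_le_neg (min_le_right _ _))
    rwa [Real.rpow_neg_one, ← one_div] at this
  have hQ : 0 ≤ momentSize (-2 * d) (1 / n) a β :=
    le_trans (by positivity) (le_momentSize (p := -2 * d) hε ha0 hβ0)
  have hLn : 0 ≤ ((ℓ : ℝ) * n) ^ (-ν) := by positivity
  have hL : 0 ≤ (ℓ : ℝ) ^ (-(min (1 - 2 * d) 1)) := by positivity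
  generalize (ℓ : ℝ) ^ (-(min (1 - 2 * d) 1)) = L at *
  generalize ((ℓ : ℝ) * n) ^ (-ν) = L' at *
  generalize momentSize (-2 * d) (1 / n) a β = Q at *
  calc _ ≤ 4000000 * B * (144 / κ * Q * L + 1 / κ * Q * (30 * L + 8 * L')) := by gcongr
    _ = 1 / κ * B * Q * (696000000 * L + 32000000 * L') := by ring
    _ ≤ 1 / κ * B * Q * (700000000 * L + 700000000 * L') := by gcongr <;> norm_num
    _ = _ := by ring

end oscillation

/-! ### Fourier frequencies and normalisation. -/

section fourierFreq

variable {n j k : ℕ}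

theorem fourierFreq_pos (hk : 1 ≤ k) (hkn : 4 * k ≤ n) : 0 < fourierFreq n k := by
  have : (0 : ℝ) < n := by exact_mod_cast (by omega : 0 < n)
  have : (0 : ℝ) < k := by exact_mod_cast (by omega : 0 < k)
  unfold fourierFreq
  positivity

theorem two_mul_fourierFreq_le (hk : 1 ≤ k) (hkn : 4 * k ≤ n) :
    2 * fourierFreq n k ≤ Real.pi := by
  have h1 : (0 : ℝ) < n := by exact_mod_cast (by omega : 0 < n)
  have h2 : (4 : ℝ) * k ≤ n := by exact_mod_cast hkn
  unfold fourierFreq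
  rw [← mul_div_assoc, div_le_iff₀ h1]
  nlinarith [Real.pi_pos]

theorem fourierFreq_le (hjk : j ≤ k) : fourierFreq n j ≤ fourierFreq n k := by
  unfold fourierFreq
  gcongr

theorem le_fourierFreq (hj : 1 ≤ j) : 2 * Real.pi * (1 / n) ≤ fourierFreq n j := by
  have : (1 : ℝ) ≤ j := by exact_mod_cast hj
  unfold fourierFreq
  rw [mul_one_div]
  exact div_le_div_of_nonneg_right (le_mul_of_one_le_right (by positivity) this) (by positivity)

theorem dirichlet_fourierFreq (hk : 1 ≤ k) (hkn : 4 * k ≤ n) :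
    dirichlet n (fourierFreq n k) = 0 := by
  have h0 := fourierFreq_pos hk hkn
  have h1 := two_mul_fourierFreq_le hk hkn
  have hn : (n : ℝ) ≠ 0 := by exact_mod_cast (by omega : n ≠ 0)
  refine dirichlet_eq_zero (m := k) h0.ne' (by rw [abs_of_pos h0]; linarith) ?_
  unfold fourierFreq
  push_cast
  field_simp

theorem dirichlet_fourierFreq_sub (hj : 1 ≤ j) (hjk : j < k) (hkn : 4 * k ≤ n) :
    dirichlet n (fourierFreq n j - fourierFreq n k) = 0 := by
  have h0 := fourierFreq_pos hj (by omega : 4 * j ≤ n)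
  have h1 := two_mul_fourierFreq_le (by omega : 1 ≤ k) hkn
  have hle := fourierFreq_le (n := n) hjk.le
  have hn : (0 : ℝ) < n := by exact_mod_cast (by omega : 0 < n)
  have hlt : fourierFreq n j < fourierFreq n k := by
    have : (j : ℝ) < k := by exact_mod_cast hjk
    unfold fourierFreq
    gcongr
  refine dirichlet_eq_zero (m := (j : ℤ) - k) (by linarith)
    (by rw [abs_of_nonpos (by linarith)]; linarith) ?_
  unfold fourierFreq
  push_cast
  field_simp

/-- The scale n cancels: ω_k/(1/n) = 2πk and (2πn)⁻¹/ω_k = 1/(4π²k). L stands for log(1+k) in (i),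
where k = 1 is allowed, and for log k otherwise. -/
theorem inv_mul_momentSize_le {p L : ℝ} (hj : 1 ≤ j) (hjk : j ≤ k) (hkn : 4 * k ≤ n)
    (hL : 1 + Real.log (1 + 2 * Real.pi * k) ≤ 6 * L) :
    (2 * Real.pi * n)⁻¹ * momentSize p (1 / n) (fourierFreq n j) (fourierFreq n k) ≤
      (fourierFreq n j ^ p + fourierFreq n k ^ p) * (L / k) := by
  have hn : (0 : ℝ) < n := by exact_mod_cast (by omega : 0 < n)
  have hk : (0 : ℝ) < k := by exact_mod_cast (by omega : 0 < k)
  have h1 := fourierFreq_pos hj (by omega : 4 * j ≤ n)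
  have h2 := fourierFreq_pos (by omega : 1 ≤ k) hkn
  have e : fourierFreq n k / (1 / n) = 2 * Real.pi * k := by
    unfold fourierFreq; field_simp
  have e2 : (2 * Real.pi * n)⁻¹ * momentSize p (1 / n) (fourierFreq n j) (fourierFreq n k) =
      (fourierFreq n j ^ p + fourierFreq n k ^ p) *
        ((1 + Real.log (1 + 2 * Real.pi * k)) / (4 * Real.pi ^ 2) / k) := by
    unfold momentSize
    rw [e]
    have : (2 * Real.pi * n)⁻¹ / fourierFreq n k = 1 / (4 * Real.pi ^ 2) / k := by
      unfold fourierFreq; field_simp; ring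
    calc _ = (fourierFreq n j ^ p + fourierFreq n k ^ p) *
          ((1 + Real.log (1 + 2 * Real.pi * k)) * ((2 * Real.pi * n)⁻¹ / fourierFreq n k)) := by
          ring
      _ = _ := by rw [this]; ring
  rw [e2]
  have hlog : 0 ≤ Real.log (1 + 2 * Real.pi * k) := Real.log_nonneg (by
    have : 0 ≤ 2 * Real.pi * k := by positivity
    linarith)
  have : (1 + Real.log (1 + 2 * Real.pi * k)) / (4 * Real.pi ^ 2) ≤ L := by
    have hL0 : 0 ≤ L := by linarith
    have hπ : 6 ≤ 4 * Real.pi ^ 2 := by nlinarith [Real.pi_gt_three]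
    rw [div_le_iff₀ (by positivity)]
    nlinarith
  have h3 : 0 < fourierFreq n j ^ p := by positivity
  have h4 : 0 < fourierFreq n k ^ p := by positivity
  gcongr

theorem one_add_log_le (hk : 1 ≤ k) :
    1 + Real.log (1 + 2 * Real.pi * k) ≤ 6 * Real.log (1 + k) := by
  have hk' : (1 : ℝ) ≤ k := by exact_mod_cast hk
  have h2 := Real.log_two_gt_d9
  have h3 : Real.log 2 ≤ Real.log (1 + k) := Real.log_le_log (by norm_num) (by linarith)
  have h4 : Real.log (1 + 2 * Real.pi * k) ≤ Real.log (2 ^ 3 * (1 + k)) := by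
    refine Real.log_le_log (by positivity) ?_
    have : Real.pi * k ≤ 4 * k := by gcongr; exact Real.pi_le_four
    linarith
  rw [Real.log_mul (by norm_num) (by positivity), Real.log_pow] at h4
  push_cast at h4
  linarith

theorem one_add_log_le_of_two_le (hk : 2 ≤ k) :
    1 + Real.log (1 + 2 * Real.pi * k) ≤ 6 * Real.log k := by
  have hk' : (2 : ℝ) ≤ k := by exact_mod_cast hk
  have h2 := Real.log_two_gt_d9
  have h3 : Real.log 2 ≤ Real.log k := Real.log_le_log (by norm_num) hk'
  have h4 : Real.log (1 + 2 * Real.pi * k) ≤ Real.log (2 ^ 3 * k) := by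
    refine Real.log_le_log (by positivity) ?_
    have : Real.pi * k ≤ 3.15 * k := by gcongr; exact Real.pi_lt_d2.le
    linarith
  rw [Real.log_mul (by norm_num) (by positivity), Real.log_pow] at h4
  push_cast at h4
  linarith

end fourierFreq

/-- For b = -ω_k the centres are always separated. For b = ω_k they are separated or comparable; in
the latter case the integral vanishes, by D(ω_j - ω_k) = 0 if ℓ = 0 and by the absence of frequency
zero if ℓ ≥ 1. -/
theorem exists_isCentering {n j k : ℕ} (f : ℝ → ℝ) (ℓ : ℕ) {b : ℝ} (hj : 1 ≤ j) (hjk : j < k)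
    (hkn : 4 * k ≤ n) (hb : b = fourierFreq n k ∨ b = -fourierFreq n k) :
    ∃ c : ℝ, IsCentering f (fourierFreq n j) b (fourierFreq n k) c ∧
      (c : ℂ) * ∫ ω in (-Real.pi)..Real.pi,
        char (ℓ * n) ω * crossKernel n (fourierFreq n j) b ω = 0 := by
  have h1 := fourierFreq_pos hj (by omega : 4 * j ≤ n)
  have h2 := fourierFreq_pos (by omega : 1 ≤ k) hkn
  rcases hb with rfl | rfl
  · rcases le_or_gt (fourierFreq n k) (2 * fourierFreq n j) with h | h
    · refine ⟨f (fourierFreq n k), Or.inr ⟨rfl, rfl, h⟩, mul_eq_zero_of_right _ ?_⟩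
      rcases Nat.eq_zero_or_pos ℓ with rfl | hℓ
      · rw [Nat.zero_mul, integral_char_zero_mul_crossKernel,
          dirichlet_fourierFreq_sub hj hjk hkn, mul_zero]
      · exact integral_char_mul_crossKernel_of_le (Nat.le_mul_of_pos_left n hℓ) _ _
    · refine ⟨0, Or.inl ⟨rfl, ?_⟩, by simp⟩
      rw [abs_of_neg (by linarith)]
      linarith
  · refine ⟨0, Or.inl ⟨rfl, ?_⟩, by simp⟩
    rw [abs_of_pos (by linarith)]
    linarith

theorem integral_mul_char_crossKernel_eq {f : ℝ → ℝ}
    (hf : IntervalIntegrable f volume (-Real.pi) Real.pi) (N n : ℕ) (a b c : ℝ) :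
    ∫ ω in (-Real.pi)..Real.pi, (f ω : ℂ) * (char N ω * crossKernel n a b ω) =
      (∫ ω in (-Real.pi)..Real.pi, ((f ω - c : ℝ) : ℂ) * (char N ω * crossKernel n a b ω)) +
      (c : ℂ) * ∫ ω in (-Real.pi)..Real.pi, char N ω * crossKernel n a b ω := by
  have hcont : Continuous (fun ω => char N ω * crossKernel n a b ω) := by fun_prop
  have h1 : IntervalIntegrable (fun ω => ((f ω - c : ℝ) : ℂ) *
      (char N ω * crossKernel n a b ω)) volume (-Real.pi) Real.pi := by
    have := hf.sub (intervalIntegrable_const (c := c))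
    exact IntervalIntegrable.mul_continuousOn ⟨this.1.ofReal, this.2.ofReal⟩ hcont.continuousOn
  rw [← intervalIntegral.integral_const_mul, ← intervalIntegral.integral_add h1
    ((hcont.intervalIntegrable _ _).const_mul _)]
  refine intervalIntegral.integral_congr fun ω _ => ?_
  push_cast; ring

/-- The lower bounds on fx and fy reduce the claim to x^{-p/2} y^{-p/2} (x^p + y^p), which depends
on x/y only. -/
theorem rpow_neg_half_mul_le {φ₀ μ p x y fx fy : ℝ} (hφ : 0 < φ₀) (hμ : 0 < μ) (hx : 0 < x)
    (hy : 0 < y) (hfx : φ₀ * x ^ p ≤ μ * fx) (hfy : φ₀ * y ^ p ≤ μ * fy) :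
    fx ^ (-(1 / 2) : ℝ) * fy ^ (-(1 / 2) : ℝ) * (x ^ p + y ^ p) ≤
      μ / φ₀ * ((x / y) ^ (p / 2) + (x / y) ^ (-(p / 2))) := by
  have key : ∀ {x f : ℝ}, 0 < x → φ₀ * x ^ p ≤ μ * f →
      f ^ (-(1 / 2) : ℝ) ≤ (φ₀ / μ) ^ (-(1 / 2) : ℝ) * x ^ (-(p / 2)) := by
    intro x f hx hf
    have h1 : φ₀ / μ * x ^ p ≤ f := by
      rw [div_mul_eq_mul_div, div_le_iff₀ hμ]; linarith
    calc f ^ (-(1 / 2) : ℝ) ≤ (φ₀ / μ * x ^ p) ^ (-(1 / 2) : ℝ) :=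
          Real.rpow_le_rpow_of_nonpos (by positivity) h1 (by norm_num)
      _ = _ := by
          rw [Real.mul_rpow (by positivity) (by positivity), ← Real.rpow_mul hx.le]
          congr 2; ring
  have hfy0 : 0 < fy := by
    have : 0 < φ₀ * y ^ p := by positivity
    exact pos_of_mul_pos_right (this.trans_le hfy) hμ.le
  have hxp : 0 < x ^ p := by positivity
  have hyp : 0 < y ^ p := by positivity
  calc _ ≤ ((φ₀ / μ) ^ (-(1 / 2) : ℝ) * x ^ (-(p / 2))) *
        ((φ₀ / μ) ^ (-(1 / 2) : ℝ) * y ^ (-(p / 2))) * (x ^ p + y ^ p) := by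
        have := key hx hfx
        have := key hy hfy
        gcongr
    _ = ((φ₀ / μ) ^ (-(1 / 2) : ℝ) * (φ₀ / μ) ^ (-(1 / 2) : ℝ)) *
        (x ^ (-(p / 2)) * x ^ p * y ^ (-(p / 2)) + x ^ (-(p / 2)) * (y ^ (-(p / 2)) * y ^ p)) := by
        ring
    _ = _ := by
        rw [← Real.rpow_add (by positivity), ← Real.rpow_add hx, ← Real.rpow_add hy,
          Real.div_rpow hx.le hy.le, Real.div_rpow hx.le hy.le]
        have e1 : (-(1 / 2) + -(1 / 2) : ℝ) = -1 := by norm_num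
        have e2 : -(p / 2) + p = p / 2 := by ring
        rw [e1, e2, Real.rpow_neg_one, inv_div, Real.rpow_neg hy.le (p / 2)]
        have : y ^ (p / 2) ≠ 0 := by positivity
        field_simp

theorem rpow_add_rpow_neg_le {r q : ℝ} (hr : 0 < r) (hr1 : r ≤ 1) :
    r ^ q + r ^ (-q) ≤ 2 * r ^ (-|q|) := by
  have h1 : r ^ q ≤ r ^ (-|q|) :=
    Real.rpow_le_rpow_of_exponent_ge hr hr1 (neg_abs_le q)
  have h2 : r ^ (-q) ≤ r ^ (-|q|) :=
    Real.rpow_le_rpow_of_exponent_ge hr hr1 (neg_le_neg (le_abs_self q))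
  linarith

/-! ### Moment bounds. -/

section moments

variable {μ ν d κ : ℝ} {φ : ℝ → ℝ} {Ω : Type*} [MeasurableSpace Ω] {P : Measure Ω}
  [IsProbabilityMeasure P] {X : ℤ → Ω → ℝ}

theorem norm_integral_dft_mul_dft_le (hφ : LocalLipschitz μ ν φ) (hν : 0 < ν) (hν1 : ν ≤ 1)
    (hκ : 0 < κ) (hd : |-2 * d| ≤ 1 - κ) (hX : HasSpectralDensity P X (memoryDensity d φ))
    {n j k : ℕ} (ℓ : ℕ) {b : ℝ} (hj : 1 ≤ j) (hjk : j < k) (hkn : 4 * k ≤ n)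
    (hb : b = fourierFreq n k ∨ b = -fourierFreq n k) {R : ℝ}
    (hR : R = if ℓ = 0 then 1 else
      (ℓ : ℝ) ^ (-(min (1 - 2 * d) 1)) + ((ℓ : ℝ) * n) ^ (-ν)) :
    ‖∫ x, dft X 0 n (fourierFreq n j) x * dft X ℓ n (-b) x ∂P‖ ≤
      700000000 / κ * (μ * φ 0) *
        ((fourierFreq n j ^ (-2 * d) + fourierFreq n k ^ (-2 * d)) * (Real.log k / k)) * R := by
  have hpi := Real.pi_pos
  have hn : (0 : ℝ) < n := by exact_mod_cast (by omega : 0 < n)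
  have h1 := fourierFreq_pos hj (by omega : 4 * j ≤ n)
  have h2 := fourierFreq_pos (by omega : 1 ≤ k) hkn
  have h3 := two_mul_fourierFreq_le (by omega : 1 ≤ k) hkn
  have hle := fourierFreq_le (n := n) hjk.le
  have hbβ : |b| = fourierFreq n k := by
    rcases hb with rfl | rfl
    · exact abs_of_pos h2
    · rw [abs_neg, abs_of_pos h2]
  have hB : 0 ≤ μ * φ 0 := by
    have hm : (0 : ℝ) ∈ Set.Icc (-Real.pi) Real.pi := ⟨by linarith, hpi.le⟩
    exact (hφ.nonneg 0 hm).trans (hφ.le_mul 0 hm)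
  obtain ⟨c, hc, hc0⟩ := exists_isCentering (memoryDensity d φ) ℓ hj hjk hkn hb
  have hQ := inv_mul_momentSize_le (p := -2 * d) hj hjk.le hkn
    (one_add_log_le_of_two_le (by omega))
  have hQ0 : 0 ≤ momentSize (-2 * d) (1 / n) (fourierFreq n j) (fourierFreq n k) :=
    le_trans (by positivity) (le_momentSize (p := -2 * d) (by positivity) h1 h2)
  have hR0 : 0 ≤ R := by rw [hR]; split_ifs <;> positivity
  have main : ‖∫ ω in (-Real.pi)..Real.pi, ((memoryDensity d φ ω - c : ℝ) : ℂ) *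
        (char (ℓ * n) ω * crossKernel n (fourierFreq n j) b ω)‖ ≤
      700000000 / κ * (μ * φ 0) *
        momentSize (-2 * d) (1 / n) (fourierFreq n j) (fourierFreq n k) * R := by
    -- For ℓ = 0 and ℓ = 1 the factor R is at least 1, so no decay is needed.
    rcases lt_or_ge ℓ 2 with hℓ | hℓ
    · have hR1 : 1 ≤ R := by
        rw [hR]
        split_ifs with h0
        · exact le_rfl
        · have : ℓ = 1 := by omega
          subst this
          rw [Nat.cast_one, Real.one_rpow]
          exact le_add_of_nonneg_right (by positivity)
      refine (norm_integral_centered_le hφ hκ hd (by omega) h1 hle hbβ h3 hc (ℓ * n)).trans ?_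
      calc _ ≤ 700000000 / κ * (μ * φ 0) *
            momentSize (-2 * d) (1 / n) (fourierFreq n j) (fourierFreq n k) * 1 := by
            rw [mul_one]
            gcongr
            norm_num
        _ ≤ _ := by gcongr
    · rw [hR, if_neg (by omega)]
      exact norm_integral_oscillating_le hφ hν hν1 hκ hd (by omega) hℓ (le_fourierFreq hj) hle
        hbβ h3 hc hX.intervalIntegrable
  rw [hX.integral_dft_mul_dft ℓ (dirichlet_fourierFreq hj (by omega)),
    integral_mul_char_crossKernel_eq hX.intervalIntegrable _ _ _ _ c, hc0, add_zero, norm_mul,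
    norm_inv, Complex.norm_real, Real.norm_eq_abs, abs_of_pos (by positivity)]
  calc _ ≤ (2 * Real.pi * n)⁻¹ * (700000000 / κ * (μ * φ 0) *
        momentSize (-2 * d) (1 / n) (fourierFreq n j) (fourierFreq n k) * R) := by gcongr
    _ = 700000000 / κ * (μ * φ 0) * ((2 * Real.pi * n)⁻¹ *
        momentSize (-2 * d) (1 / n) (fourierFreq n j) (fourierFreq n k)) * R := by ring
    _ ≤ _ := by gcongr

theorem normalizedCrossMoment_le (hφ : LocalLipschitz μ ν φ) (hν : 0 < ν) (hν1 : ν ≤ 1)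
    (hκ : 0 < κ) (hd : |-2 * d| ≤ 1 - κ) (hμ : 0 < μ) (hφ0 : 0 < φ 0)
    (hlow : ∀ ω : ℝ, |ω| ≤ Real.pi / 2 → φ 0 ≤ μ * φ ω)
    (hX : HasSpectralDensity P X (memoryDensity d φ))
    {n j k : ℕ} (ℓ : ℕ) (hj : 1 ≤ j) (hjk : j < k) (hkn : 4 * k ≤ n) {R : ℝ}
    (hR : R = if ℓ = 0 then 1 else
      (ℓ : ℝ) ^ (-(min (1 - 2 * d) 1)) + ((ℓ : ℝ) * n) ^ (-ν)) :
    normalizedCrossMoment P X (memoryDensity d φ) n j k ℓ ≤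
      2800000000 * μ ^ 2 / κ * Real.log k * (j : ℝ) ^ (-|d|) * (k : ℝ) ^ (|d| - 1) * R := by
  have hn : (0 : ℝ) < n := by exact_mod_cast (by omega : 0 < n)
  have hj' : (0 : ℝ) < j := by exact_mod_cast (by omega : 0 < j)
  have hk' : (0 : ℝ) < k := by exact_mod_cast (by omega : 0 < k)
  have h1 := fourierFreq_pos hj (by omega : 4 * j ≤ n)
  have h2 := fourierFreq_pos (by omega : 1 ≤ k) hkn
  have h3 := two_mul_fourierFreq_le (by omega : 1 ≤ k) hkn
  have hle := fourierFreq_le (n := n) hjk.le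
  have hR0 : 0 ≤ R := by rw [hR]; split_ifs <;> positivity
  have hlog : 0 ≤ Real.log k := Real.log_natCast_nonneg k
  have m1 := norm_integral_dft_mul_dft_le hφ hν hν1 hκ hd hX ℓ hj hjk hkn (Or.inl rfl) hR
  have m2 := norm_integral_dft_mul_dft_le hφ hν hν1 hκ hd hX ℓ hj hjk hkn (Or.inr rfl) hR
  rw [neg_neg] at m2
  have w := rpow_neg_half_mul_le (p := -2 * d) hφ0 hμ h1 h2
    (by have := le_memoryDensity (d := d) (hlow (fourierFreq n j)
          (by rw [abs_of_pos h1]; linarith))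
        rwa [abs_of_pos h1] at this)
    (by have := le_memoryDensity (d := d) (hlow (fourierFreq n k)
          (by rw [abs_of_pos h2]; linarith))
        rwa [abs_of_pos h2] at this)
  have er : fourierFreq n j / fourierFreq n k = (j : ℝ) / k := by
    unfold fourierFreq; field_simp
  have ed : -2 * d / 2 = -d := by ring
  rw [er, ed] at w
  have hjk1 : (j : ℝ) / k ≤ 1 := (div_le_one hk').2 (by exact_mod_cast hjk.le)
  have w2 := w.trans (mul_le_mul_of_nonneg_left
    (rpow_add_rpow_neg_le (q := -d) (by positivity) hjk1) (by positivity))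
  rw [abs_neg, Real.div_rpow hj'.le hk'.le, Real.rpow_neg hk'.le, div_inv_eq_mul] at w2
  have hkd : (k : ℝ) ^ (|d| - 1) = (k : ℝ) ^ |d| / k := by
    rw [Real.rpow_sub hk', Real.rpow_one]
  have nn : ∀ {x : ℝ}, |x| ≤ Real.pi → 0 ≤ memoryDensity d φ x :=
    fun h => (memoryDensity_mem_Icc _ hφ h).1
  have f1 := nn (x := fourierFreq n j) (by rw [abs_of_pos h1]; linarith)
  have f2 := nn (x := fourierFreq n k) (by rw [abs_of_pos h2]; linarith)
  unfold normalizedCrossMoment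
  simp only [conj_dft]
  set A := memoryDensity d φ (fourierFreq n j) ^ (-(1 / 2) : ℝ) *
    memoryDensity d φ (fourierFreq n k) ^ (-(1 / 2) : ℝ) with hA
  have hA0 : 0 ≤ A := by positivity
  calc _ ≤ A * (700000000 / κ * (μ * φ 0) *
        ((fourierFreq n j ^ (-2 * d) + fourierFreq n k ^ (-2 * d)) * (Real.log k / k)) * R +
        700000000 / κ * (μ * φ 0) *
        ((fourierFreq n j ^ (-2 * d) + fourierFreq n k ^ (-2 * d)) * (Real.log k / k)) * R) := by
        gcongr
    _ = 1400000000 / κ * (μ * φ 0) *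
        (A * (fourierFreq n j ^ (-2 * d) + fourierFreq n k ^ (-2 * d))) *
          (Real.log k / k) * R := by ring
    _ ≤ 1400000000 / κ * (μ * φ 0) *
        (μ / φ 0 * (2 * ((j : ℝ) ^ (-|d|) * (k : ℝ) ^ |d|))) * (Real.log k / k) * R := by
        gcongr
    _ = _ := by rw [hkd]; field_simp; ring

/-- The centred estimate with a = b = β and c = f(β). Here the subtracted constant contributes: its
integral is c · 2π D(0) = 2πn c, which is the main term. -/
theorem abs_integral_periodogram_sub_one_le (hφ : LocalLipschitz μ ν φ)
    (hκ : 0 < κ) (hd : |-2 * d| ≤ 1 - κ) (hμ : 0 < μ) (hφ0 : 0 < φ 0)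
    (hlow : ∀ ω : ℝ, |ω| ≤ Real.pi / 2 → φ 0 ≤ μ * φ ω)
    (hX : HasSpectralDensity P X (memoryDensity d φ)) {n k : ℕ} (hk : 1 ≤ k) (hkn : 4 * k ≤ n) :
    |(∫ x, (memoryDensity d φ (fourierFreq n k))⁻¹ *
        periodogram X 0 n (fourierFreq n k) x ∂P) - 1| ≤
      2800000000 * μ ^ 2 / κ * (Real.log (1 + k) / k) := by
  have hn : (0 : ℝ) < n := by exact_mod_cast (by omega : 0 < n)
  have hk' : (0 : ℝ) < k := by exact_mod_cast (by omega : 0 < k)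
  have h2 := fourierFreq_pos hk hkn
  have h3 := two_mul_fourierFreq_le hk hkn
  have hQ := inv_mul_momentSize_le (p := -2 * d) hk le_rfl hkn (one_add_log_le hk)
  set β := fourierFreq n k with hβ
  set c := memoryDensity d φ β with hc
  have hlo : φ 0 * β ^ (-2 * d) ≤ μ * c := by
    have := le_memoryDensity (d := d) (hlow β (by rw [abs_of_pos h2]; linarith))
    rwa [abs_of_pos h2] at this
  have hβp : 0 < β ^ (-2 * d) := by positivity
  have hc0 : 0 < c := by
    have : 0 < φ 0 * β ^ (-2 * d) := by positivity
    exact pos_of_mul_pos_right (this.trans_le hlo) hμ.le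
  have hlog : 0 ≤ Real.log (1 + (k : ℝ)) := Real.log_nonneg (by linarith)
  have hm := norm_integral_centered_le hφ hκ hd (by omega : 1 ≤ n) h2 le_rfl (abs_of_pos h2) h3
    (c := c) (Or.inr ⟨rfl, rfl, by linarith⟩) (0 * n)
  have e1 : ((∫ x, periodogram X 0 n β x ∂P : ℝ) : ℂ) =
      ∫ x, dft X 0 n β x * dft X 0 n (-β) x ∂P := by
    rw [← integral_complex_ofReal]
    refine integral_congr_ae (Filter.Eventually.of_forall fun x => ?_)
    simp only [periodogram]
    rw [← conj_dft, Complex.mul_conj, Complex.normSq_eq_norm_sq]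
  have e2 : ((∫ x, periodogram X 0 n β x ∂P : ℝ) : ℂ) =
      ((2 * Real.pi * n : ℝ) : ℂ)⁻¹ * (∫ ω in (-Real.pi)..Real.pi,
        ((memoryDensity d φ ω - c : ℝ) : ℂ) * (char (0 * n) ω * crossKernel n β β ω)) + c := by
    rw [e1, hX.integral_dft_mul_dft 0 (dirichlet_fourierFreq hk hkn),
      integral_mul_char_crossKernel_eq hX.intervalIntegrable _ _ _ _ c, mul_add]
    congr 1
    rw [Nat.zero_mul, integral_char_zero_mul_crossKernel, sub_self]
    have : dirichlet n 0 = n := by simp [dirichlet]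
    rw [this]
    have hnC : (n : ℂ) ≠ 0 := by exact_mod_cast hn.ne'
    have hπC : (Real.pi : ℂ) ≠ 0 := by exact_mod_cast Real.pi_ne_zero
    push_cast
    field_simp
  have e3 : |(∫ x, periodogram X 0 n β x ∂P) - c| ≤
      (2 * Real.pi * n)⁻¹ * (174240 / κ * (μ * φ 0) * momentSize (-2 * d) (1 / n) β β) := by
    have : ((((∫ x, periodogram X 0 n β x ∂P) - c : ℝ)) : ℂ) =
        ((2 * Real.pi * n : ℝ) : ℂ)⁻¹ * (∫ ω in (-Real.pi)..Real.pi,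
        ((memoryDensity d φ ω - c : ℝ) : ℂ) * (char (0 * n) ω * crossKernel n β β ω)) := by
      rw [Complex.ofReal_sub, e2, add_sub_cancel_right]
    rw [← Real.norm_eq_abs, ← Complex.norm_real, this, norm_mul, norm_inv, Complex.norm_real,
      Real.norm_eq_abs, abs_of_pos (by positivity)]
    gcongr
  rw [integral_const_mul]
  have e4 : c⁻¹ * (∫ x, periodogram X 0 n β x ∂P) - 1 =
      ((∫ x, periodogram X 0 n β x ∂P) - c) / c := by field_simp
  rw [e4, abs_div, abs_of_pos hc0, div_le_iff₀ hc0]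
  calc _ ≤ 174240 / κ * (μ * φ 0) * ((2 * Real.pi * n)⁻¹ *
        momentSize (-2 * d) (1 / n) β β) := by rw [mul_left_comm] at e3; linarith
    _ ≤ 174240 / κ * (μ * φ 0) * ((β ^ (-2 * d) + β ^ (-2 * d)) * (Real.log (1 + k) / k)) := by
        gcongr
    _ = 348480 * μ / κ * (Real.log (1 + k) / k) * (φ 0 * β ^ (-2 * d)) := by ring
    _ ≤ 348480 * μ / κ * (Real.log (1 + k) / k) * (μ * c) := by gcongr
    _ = 348480 * (μ ^ 2 / κ * (Real.log (1 + k) / k) * c) := by ring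
    -- Enlarged so that one C serves all three parts.
    _ ≤ 2800000000 * (μ ^ 2 / κ * (Real.log (1 + k) / k) * c) := by gcongr; norm_num
    _ = _ := by ring

end moments

end LongMemory

end

open LongMemory
-- The theorem.
theorem mainTheorem2 (δm δp μ : ℝ) (hδm : 0 ≤ δm) (hδm' : δm < 1 / 2)
    (hδp : 0 ≤ δp) (hδp' : δp < 1 / 2) (hμ : 1 ≤ μ) :
    ∃ C : ℝ, ∀ (ν d : ℝ) (fstar : ℝ → ℝ),
      0 < ν → ν ≤ 1 → -δm ≤ d → d ≤ δp →
      IsShortMemoryFactor fstar → LocalLipschitz μ ν fstar →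
      (∀ ω : ℝ, |ω| ≤ Real.pi / 2 → fstar 0 ≤ μ * fstar ω) →
      ∀ (Ω : Type*) [MeasurableSpace Ω] (P : Measure Ω) [IsProbabilityMeasure P]
        (X : ℤ → Ω → ℝ), HasSpectralDensity P X (memoryDensity d fstar) →
      -- bias of the normalized periodogram
      (∀ n k : ℕ, 1 ≤ k → 4 * k ≤ n →
        |(∫ x, (memoryDensity d fstar (fourierFreq n k))⁻¹ *
            periodogram X 0 n (fourierFreq n k) x ∂P) - 1|
          ≤ C * (Real.log (1 + k) / k)) ∧
      -- DFT moments across different epochs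
      (∀ n j k ℓ : ℕ, 1 ≤ j → j < k → 4 * k ≤ n → 1 ≤ ℓ →
        normalizedCrossMoment P X (memoryDensity d fstar) n j k ℓ
          ≤ C * Real.log k * (j : ℝ) ^ (-|d|) * (k : ℝ) ^ (|d| - 1) *
            ((ℓ : ℝ) ^ (-(min (1 - 2 * d) 1)) + ((ℓ : ℝ) * (n : ℝ)) ^ (-ν))) ∧
      -- DFT moments within one epoch
      (∀ n j k : ℕ, 1 ≤ j → j < k → 4 * k ≤ n →
        normalizedCrossMoment P X (memoryDensity d fstar) n j k 0
          ≤ C * Real.log k * (j : ℝ) ^ (-|d|) * (k : ℝ) ^ (|d| - 1)) := by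
  have hμ0 : 0 < μ := by linarith
  -- This κ keeps |2d| ≤ 1 - κ uniformly over the allowed d.
  have hκ : 0 < 1 - 2 * max δm δp := by
    have := max_lt hδm' hδp'
    linarith
  refine ⟨2800000000 * μ ^ 2 / (1 - 2 * max δm δp), ?_⟩
  intro ν d fstar hν hν1 hdm hdp hS hL hlow Ω _ P _ X hX
  have hd : |-2 * d| ≤ 1 - (1 - 2 * max δm δp) := by
    have h1 := le_max_left δm δp
    have h2 := le_max_right δm δp
    rw [abs_le]
    constructor <;> linarith
  refine ⟨fun n k hk hkn =>
    abs_integral_periodogram_sub_one_le hL hκ hd hμ0 hS.pos_zero hlow hX hk hkn,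
    fun n j k ℓ hj hjk hkn hℓ =>
      normalizedCrossMoment_le hL hν hν1 hκ hd hμ0 hS.pos_zero hlow hX ℓ hj hjk hkn
        (by rw [if_neg (by omega)]), fun n j k hj hjk hkn => ?_⟩
  have := normalizedCrossMoment_le hL hν hν1 hκ hd hμ0 hS.pos_zero hlow hX 0 hj hjk hkn
    (R := 1) (by rw [if_pos rfl])
  rwa [mul_one] at this
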